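/- **Setting.** Let $E$ be a reflexive real Banach space and $E^*$ its dual, $K\subset E$ nonempty, closed and convex, $Y\neq\{0\}$ a real Banach space and $C\subset Y$ a closed convex cone with $C\cap(-C)=\{0\}$ and $\operatorname{int}C\ne\emptyset$. Let $f:E\times E\to Y$ satisfy - B1: $f(x,x)=0$ for all $x\in E$; - B2: $f$ is uniformly continuous on bounded subsets of $E\times E$; - B3: $f(x,\cdot)$ is $C$-convex for all $x\in E$: $t f(x,a)+(1-t)f(x,b)-f(x,ta+(1-t)b)\in C$ for $a,b\in E$, $t\in[0,1]$. Let $g:E\to\mathbb R$ be strictly convex, lower semicontinuous and Gâteaux differentiable, with derivative $g':E\to E^*$ and Bregman distance $D_g(x,y)=g(x)-g(y)-\langle x-y,g'(y)\rangle$, and assume - H1: for each $x\in E$ the level sets of $D_g(x,\cdot)$ are bounded; - H2: $\inf_{x\in A}\inf\{D_g(y,x):\|y-x\|=t\}>0$ for all bounded $A\subset E$ and $t>0$ (with $\inf\emptyset=+\infty$); - H3: $g'$ is uniformly continuous on bounded subsets of $E$; - H4: $\lim_{\|x\|\to\infty}(g(x)-\rho\|x-z\|)=\infty$ for all $z\in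 E$, $\rho>0$. The Bregman projection $\Pi^g_A(x)$ is the minimizer of $D_g(\cdot,x)$ over $A$. Let $T$ assign to each $x\in K$ a set $T(x)\subset K$, and let $\mathrm{Fix}(T)=\{x\in K:x\in T(x)\}$. Assume - B4: the sets $T(x)$ are nonempty, closed and convex; $T$ is demiclosed (if $x^k\in K$, $x^k\rightharpoonup \bar x$ and $d(x^k,T(x^k))\to0$, then $\bar x\in\mathrm{Fix}(T)$); $T$ is lower semicontinuous (if $x^k\in K$, $x^k\to\bar x\in K$ and $\bar y\in T(\bar x)$, there are $y^k\in T(x^k)$ with $y^k\to\bar y$); and $T$ is quasi $D_g$-nonexpansive (the map $S(x)=\Pi^g_{T(x)}(x)$ on $K$ has a fixed point, and $D_g(p,S(x))\le D_g(p,x)$ for every fixed point $p$ of $S$ and every $x\in K$). Put $S(f,T)=\{x\in \mathrm{Fix}(T): f(x,y)\notin-\operatorname{int}C\ \forall y\in T(x)\}$ (the solution set of the vector quasi-equilibrium problem) and $DS(f,T)=\{x\in\mathrm{Fix}(T): f(y,x)\in -C\ \forall y\in K\}$. **Algorithm SEML.** Fix $v^0\in K$, $\delta,\theta\in(0,1)$,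 $0<\hat\beta\le\tilde\beta$, $\beta_k\in[\hat\beta,\tilde\beta]$, $\varepsilon\in(0,1]$, $\gamma_k\in[\varepsilon,1]$, and $e^k\in\operatorname{int}C$ with $e^k\to\bar e\in\operatorname{int}C$. Given $v^k$, let $x^k=\Pi^g_{T(v^k)}(v^k)$. Choose $z^k\in T(v^k)$ weakly efficient for $G_k(y)=\beta_kf(x^k,y)+g(y)e^k-\langle y,g'(x^k)\rangle e^k$ over $T(v^k)$, i.e. such that $G_k(z^k)-G_k(y)\notin\operatorname{int}C$ for all $y\in T(v^k)$. If $z^k=v^k$, stop. Otherwise, with $y^{(\ell)}=\theta^\ell z^k+(1-\theta^\ell)x^k$, let $\ell(k)$ be the least $\ell\ge0$ such that $$-\beta_kf(y^{(\ell)},x^k)+\beta_kf(y^{(\ell)},z^k)+\delta D_g(z^k,x^k)e^k\notin\operatorname{int}C,$$ and put $y^k=y^{(\ell(k))}$, $H_k=\{y\in E:f(y^k,y)\in-C\}$, $K_k=K\cap H_0\cap\dots\cap H_k$, $w^k=\Pi^g_{K_k}(x^k)$ and $v^{k+1}=\Pi^g_{L_k\cap M_k\cap N_k}(v^0)$, where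 $$L_k=\{z\in K:\langle z-x^k,g'(x^k)-g'(w^k)\rangle\le-\gamma_kD_g(x^k,w^k)\},$$ $$M_k=\{z\in K:\langle z-v^k,g'(v^k)-g'(x^k)\rangle\le-\gamma_kD_g(v^k,x^k)\},$$ $$N_k=\{z\in K:\langle z-v^k,g'(v^0)-g'(v^k)\rangle\le0\}.$$ Let $K_\infty=\bigcap_kK_k$. **Theorem.** (i) If $DS(f,T)\ne\emptyset$, then the sequences $\{x^k\},\{v^k\},\{w^k\}$ are well defined and bounded. That is, whatever choices of $z^0,\dots,z^{k-1}$ were made without stopping, $v^k\in K$, $x^k$ exists and is unique and an admissible $z^k$ exists; for every admissible $z^k\neq v^k$ the linesearch is finite and $w^k$ and $v^{k+1}$ exist and are unique; and for every infinite run the three sequences are bounded. (ii) If the algorithm generates infinite sequences $\{x^k\},\{v^k\},\{w^k\}$ and these are bounded, then $\{v^k\}$ and $\{x^k\}$ converge strongly to one common point of $S(f,T)$, namely $\Pi^g_{K_\infty\cap\mathrm{Fix}(T)}(v^0)$. If instead the algorithm stops in iteration $n$, then $x^n=v^n\in S(f,T)$. In both cases $S(f,T)\neq\emptyset$. -/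

import Mathlib

open Set Filter Topology Bornology

namespace VQEP

noncomputable section

section Bregman

variable {E : Type*} [NormedAddCommGroup E] [NormedSpace ℝ E]

/-- Reflexivity: the canonical map from `E` into its bidual is onto. -/
def IsReflexive (E : Type*) [NormedAddCommGroup E] [NormedSpace ℝ E] : Prop :=
  Function.Surjective (NormedSpace.inclusionInDoubleDual ℝ E)

/-- `φ` is the Gateaux derivative of `g` at `x`: a continuous linear functional that gives all the
directional derivatives of `g` at `x`. -/
def HasGateauxDerivAt (g : E → ℝ) (φ : StrongDual ℝ E) (x : E) : Prop :=
  ∀ h : E, HasLineDerivAt ℝ g (φ h) x h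

/-- `g` is Gateaux differentiable on all of `E`. -/
def GateauxDifferentiable (g : E → ℝ) : Prop :=
  ∀ x : E, ∃ φ : StrongDual ℝ E, HasGateauxDerivAt g φ x

open Classical in
/-- The Gateaux derivative `g' : E → E*` (with value `0` where it does not exist). -/
def gateauxDeriv (g : E → ℝ) (x : E) : StrongDual ℝ E :=
  if h : ∃ φ : StrongDual ℝ E, HasGateauxDerivAt g φ x then h.choose else 0

/-- The family of strictly convex, lower semicontinuous, Gateaux differentiable real functions. -/
structure IsBregmanFunction (g : E → ℝ) : Prop where
  strictConvex : StrictConvexOn ℝ univ g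
  lsc : LowerSemicontinuous g
  gateaux : GateauxDifferentiable g

/-- The Bregman distance `D_g(x, y) = g(x) - g(y) - ⟨x - y, g'(y)⟩`. -/
def bregmanDist (g : E → ℝ) (x y : E) : ℝ :=
  g x - g y - gateauxDeriv g y (x - y)

/-- The modulus of total convexity `v_g(x, t) = inf {D_g(y, x) : ‖y - x‖ = t}`. It takes extended
real values so that the infimum over the empty set is `+∞`. -/
def totalConvexityModulus (g : E → ℝ) (x : E) (t : ℝ) : EReal :=
  ⨅ y : {y : E // ‖y - x‖ = t}, (bregmanDist g y.1 x : EReal)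

/-- H1: the level sets of `D_g(x, ·)` are bounded, for all `x`. -/
def H1 (g : E → ℝ) : Prop :=
  ∀ (x : E) (r : ℝ), IsBounded {y : E | bregmanDist g x y ≤ r}

/-- H2: `g` is uniformly totally convex on `E`. -/
def H2 (g : E → ℝ) : Prop :=
  ∀ A : Set E, IsBounded A → ∀ t : ℝ, 0 < t → 0 < ⨅ x ∈ A, totalConvexityModulus g x t

/-- H3: `g'` is uniformly continuous on bounded subsets of `E`. -/
def H3 (g : E → ℝ) : Prop :=
  ∀ A : Set E, IsBounded A → UniformContinuousOn (gateauxDeriv g) A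

/-- H4: `g(x) - ρ ‖x - z‖ → ∞` as `‖x‖ → ∞`, for all `z` and all `ρ > 0`. -/
def H4 (g : E → ℝ) : Prop :=
  ∀ (z : E) (ρ : ℝ), 0 < ρ → Tendsto (fun x => g x - ρ * ‖x - z‖) (comap norm atTop) atTop

/-- `p` is a Bregman projection of `x` onto `A`, i.e. `p ∈ argmin {D_g(y, x) : y ∈ A}`. -/
def IsBregmanProj (g : E → ℝ) (A : Set E) (x p : E) : Prop :=
  p ∈ A ∧ ∀ y ∈ A, bregmanDist g p x ≤ bregmanDist g y x

/-- Weak convergence of a sequence. -/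
def WeaklyTendsto (u : ℕ → E) (a : E) : Prop :=
  ∀ φ : StrongDual ℝ E, Tendsto (fun k => φ (u k)) atTop (𝓝 (φ a))

/-! Multivalued mappings `T : K → P(K)` are functions `T : E → Set E` of which only the values at
points of `K` are ever used. -/

/-- The fixed points of the multivalued mapping `T` on `K`. -/
def Fix (K : Set E) (T : E → Set E) : Set E :=
  {x | x ∈ K ∧ x ∈ T x}

/-- A single-valued `S : K → K` is quasi `D_g`-nonexpansive: it has a fixed point, and
`D_g(p, S x) ≤ D_g(p, x)` for all fixed points `p` and all `x ∈ K`. -/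
def QuasiNonexpansive (g : E → ℝ) (K : Set E) (S : E → E) : Prop :=
  MapsTo S K K ∧ (∃ p ∈ K, S p = p) ∧
    ∀ p ∈ K, S p = p → ∀ x ∈ K, bregmanDist g p (S x) ≤ bregmanDist g p x

/-- A multivalued `T` on `K` is quasi `D_g`-nonexpansive: the mapping `S` taking `x ∈ K` to the
Bregman projection of `x` onto `T x` is quasi `D_g`-nonexpansive. -/
def QuasiNonexpansiveMulti (g : E → ℝ) (K : Set E) (T : E → Set E) : Prop :=
  ∃ S : E → E, (∀ x ∈ K, IsBregmanProj g (T x) x (S x)) ∧ QuasiNonexpansive g K S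

/-- `T` is demiclosed: `x^k ⇀ a` and `d(x^k, T(x^k)) → 0` imply that `a` is a fixed point. -/
def Demiclosed (K : Set E) (T : E → Set E) : Prop :=
  ∀ (u : ℕ → E) (a : E), (∀ k, u k ∈ K) → WeaklyTendsto u a →
    Tendsto (fun k => Metric.infDist (u k) (T (u k))) atTop (𝓝 0) → a ∈ Fix K T

/-- `T` is (sequentially) lower semicontinuous at each point of `K`. -/
def LowerSemicontinuousMulti (K : Set E) (T : E → Set E) : Prop :=
  ∀ a ∈ K, ∀ u : ℕ → E, (∀ k, u k ∈ K) → Tendsto u atTop (𝓝 a) →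
    ∀ b ∈ T a, ∃ q : ℕ → E, (∀ k, q k ∈ T (u k)) ∧ Tendsto q atTop (𝓝 b)

/-- B4: `T` maps points of `K` to nonempty, closed, convex subsets of `K`, and it is demiclosed, lower
semicontinuous and quasi `D_g`-nonexpansive. -/
structure B4 (g : E → ℝ) (K : Set E) (T : E → Set E) : Prop where
  subset : ∀ x ∈ K, T x ⊆ K
  nonempty : ∀ x ∈ K, (T x).Nonempty
  closed : ∀ x ∈ K, IsClosed (T x)
  convex : ∀ x ∈ K, Convex ℝ (T x)
  demiclosed : Demiclosed K T
  lsc : LowerSemicontinuousMulti K T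
  quasi : QuasiNonexpansiveMulti g K T

/-- The half-space `{z : ⟨z - a, g'(a) - g'(b)⟩ ≤ -γ D_g(a, b)}`. -/
def bregmanCut (g : E → ℝ) (γ : ℝ) (a b : E) : Set E :=
  {z | (gateauxDeriv g a - gateauxDeriv g b) (z - a) ≤ -γ * bregmanDist g a b}

/-- The half-space `N_k = {z : ⟨z - v, g'(v0) - g'(v)⟩ ≤ 0}`, where `v = v^k`. -/
def originCut (g : E → ℝ) (v0 v : E) : Set E :=
  {z | (gateauxDeriv g v0 - gateauxDeriv g v) (z - v) ≤ 0}

end Bregman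

section Vector

variable {E Y : Type*} [NormedAddCommGroup E] [NormedSpace ℝ E]
  [NormedAddCommGroup Y] [NormedSpace ℝ Y]

/-! A `ProperCone ℝ Y` is a closed convex cone in `Y` containing `0`. -/

/-- The standing assumptions on the ordering cone: it is closed and convex (being a `ProperCone`),
pointed in the sense `C ∩ (-C) = {0}`, and has nonempty interior. -/
structure IsOrderingCone (C : ProperCone ℝ Y) : Prop where
  pointed : ∀ u ∈ C, -u ∈ C → u = 0
  interior_nonempty : (interior (C : Set Y)).Nonempty

/-- `C`-convexity of `G`, i.e. `G(t a + (1 - t) b) ⪯ t G(a) + (1 - t) G(b)`. -/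
def CConvex (C : ProperCone ℝ Y) (G : E → Y) : Prop :=
  ∀ (a b : E) (t : ℝ), 0 ≤ t → t ≤ 1 →
    (t • G a + (1 - t) • G b) - G (t • a + (1 - t) • b) ∈ C

/-- The weakly efficient points of `G` on `S`: the points `a ∈ S` for which no `s ∈ S` satisfies
`G(s) ≺ G(a)`, i.e. `G(a) - G(s) ∈ int C`. -/
def weakArgmin (C : ProperCone ℝ Y) (G : E → Y) (S : Set E) : Set E :=
  {a | a ∈ S ∧ ∀ s ∈ S, G a - G s ∉ interior (C : Set Y)}

/-- B1: `f(x, x) = 0`. -/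
def B1 (f : E → E → Y) : Prop := ∀ x, f x x = 0

/-- B2: `f` is uniformly continuous on bounded subsets of `E × E`. -/
def B2 (f : E → E → Y) : Prop :=
  ∀ A : Set (E × E), IsBounded A → UniformContinuousOn (fun q : E × E => f q.1 q.2) A

/-- B3: `f(x, ·)` is `C`-convex for all `x`. -/
def B3 (C : ProperCone ℝ Y) (f : E → E → Y) : Prop := ∀ x, CConvex C (f x)

/-- The solution set of the vector quasi-equilibrium problem. -/
def S (K : Set E) (C : ProperCone ℝ Y) (f : E → E → Y) (T : E → Set E) : Set E :=
  {x | x ∈ Fix K T ∧ ∀ y ∈ T x, -f x y ∉ interior (C : Set Y)}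

/-- The dual solution set: the `x ∈ T(x)` with `f(y, x) ∈ -C` for all `y ∈ K`. -/
def DS (K : Set E) (C : ProperCone ℝ Y) (f : E → E → Y) (T : E → Set E) : Set E :=
  {x | x ∈ Fix K T ∧ ∀ y ∈ K, -f y x ∈ C}

/-- The initialization of the algorithm: starting point and parameters. -/
structure Params (K : Set E) (C : ProperCone ℝ Y) where
  v0 : E
  δ : ℝ
  θ : ℝ
  βlo : ℝ
  βhi : ℝ
  β : ℕ → ℝ
  ε : ℝ
  γ : ℕ → ℝ
  e : ℕ → Y
  ebar : Y
  v0_mem : v0 ∈ K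
  δ_mem : δ ∈ Ioo (0 : ℝ) 1
  θ_mem : θ ∈ Ioo (0 : ℝ) 1
  βlo_pos : 0 < βlo
  βlo_le : βlo ≤ βhi
  β_mem : ∀ k, β k ∈ Icc βlo βhi
  ε_mem : ε ∈ Ioc (0 : ℝ) 1
  γ_mem : ∀ k, γ k ∈ Icc ε 1
  e_mem : ∀ k, e k ∈ interior (C : Set Y)
  ebar_mem : ebar ∈ interior (C : Set Y)
  e_tendsto : Tendsto e atTop (𝓝 ebar)

/-- The sequences that the algorithm produces. -/
structure Iterates (E : Type*) where
  v : ℕ → E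
  x : ℕ → E
  z : ℕ → E
  ℓ : ℕ → ℕ
  y : ℕ → E
  w : ℕ → E

/-- The candidates for `z^k`: the weakly efficient points over `y ∈ T(v)` of
`β f(x, y) + g(y) e - ⟨y, g'(x)⟩ e`. -/
def zCandidates (C : ProperCone ℝ Y) (f : E → E → Y) (T : E → Set E) (g : E → ℝ)
    (β : ℝ) (e : Y) (v x : E) : Set E :=
  weakArgmin C (fun y => β • f x y + g y • e - (gateauxDeriv g x y) • e) (T v)

/-- The trial points `θ^ℓ z + (1 - θ^ℓ) x` of the linesearch. -/
def trialPoint (θ : ℝ) (x z : E) (l : ℕ) : E := θ ^ l • z + (1 - θ ^ l) • x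

/-- The exponents accepted by the Armijo linesearch. -/
def acceptedExponents (C : ProperCone ℝ Y) (f : E → E → Y) (g : E → ℝ)
    (δ θ β : ℝ) (e : Y) (x z : E) : Set ℕ :=
  {l | -(β • f (trialPoint θ x z l) x) + β • f (trialPoint θ x z l) z
      + (δ * bregmanDist g z x) • e ∉ interior (C : Set Y)}

/-- `H = {u : f(y, u) ∈ -C}`. -/
def cutH (C : ProperCone ℝ Y) (f : E → E → Y) (y : E) : Set E := {u | -f y u ∈ C}

/-- `K ∩ H_0 ∩ ⋯ ∩ H_{k-1}`; thus `cutSet K C f y (k + 1)` is the set `K_k` of the algorithm. -/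
def cutSet (K : Set E) (C : ProperCone ℝ Y) (f : E → E → Y) (y : ℕ → E) : ℕ → Set E
  | 0 => K
  | k + 1 => cutSet K C f y k ∩ cutH C f (y k)

/-- `K_∞ = ⋂ K_k`. -/
def cutSetInf (K : Set E) (C : ProperCone ℝ Y) (f : E → E → Y) (y : ℕ → E) : Set E :=
  ⋂ k, cutSet K C f y (k + 1)

/-- The set `K ∩ L_k ∩ M_k ∩ N_k` onto which `v^0` is projected to obtain `v^{k+1}`. The half-spaces
are taken inside `K`, because `v^{k+1}` has to be a point of `K` for `T(v^{k+1})` to make sense. -/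
def nextSet (K : Set E) (g : E → ℝ) (γ : ℝ) (v0 v x w : E) : Set E :=
  K ∩ (bregmanCut g γ x w ∩ bregmanCut g γ v x ∩ originCut g v0 v)

variable (K : Set E) (C : ProperCone ℝ Y) (f : E → E → Y) (T : E → Set E) (g : E → ℝ)

/-- Iteration `k` of the algorithm is carried out completely (without stopping). -/
structure Step (P : Params K C) (s : Iterates E) (k : ℕ) : Prop where
  x_proj : IsBregmanProj g (T (s.v k)) (s.v k) (s.x k)
  z_mem : s.z k ∈ zCandidates C f T g (P.β k) (P.e k) (s.v k) (s.x k)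
  z_ne_v : s.z k ≠ s.v k
  linesearch : IsLeast (acceptedExponents C f g P.δ P.θ (P.β k) (P.e k) (s.x k) (s.z k)) (s.ℓ k)
  y_eq : s.y k = trialPoint P.θ (s.x k) (s.z k) (s.ℓ k)
  w_proj : IsBregmanProj g (cutSet K C f s.y (k + 1)) (s.x k) (s.w k)
  v_next : IsBregmanProj g (nextSet K g (P.γ k) P.v0 (s.v k) (s.x k) (s.w k)) P.v0 (s.v (k + 1))

/-- The iterations `0, …, n - 1` have been carried out completely, so that `v^0, …, v^n` are
available. Entries of `s` with larger index are irrelevant. -/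
def PartialRun (P : Params K C) (s : Iterates E) (n : ℕ) : Prop :=
  s.v 0 = P.v0 ∧ ∀ k < n, Step K C f T g P s k

/-- An infinite run of the algorithm. -/
def Run (P : Params K C) (s : Iterates E) : Prop :=
  s.v 0 = P.v0 ∧ ∀ k, Step K C f T g P s k

/-- The algorithm stops in iteration `n`, because `z^n = v^n`. -/
structure StopsAt (P : Params K C) (s : Iterates E) (n : ℕ) : Prop where
  partialRun : PartialRun K C f T g P s n
  x_proj : IsBregmanProj g (T (s.v n)) (s.v n) (s.x n)
  z_mem : s.z n ∈ zCandidates C f T g (P.β n) (P.e n) (s.v n) (s.x n)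
  z_eq_v : s.z n = s.v n

/-- The sequences of the algorithm are well defined: whatever has been generated in iterations
`0, …, n - 1`, the point `v^n` lies in `K`, and iteration `n` can be carried out. That is, `x^n`
exists and is unique, some `z^n` exists, and for every admissible choice of `z^n` at which the
algorithm does not stop, the linesearch is finite and `w^n`, `v^{n+1}` exist and are unique. -/
def WellDefined (P : Params K C) : Prop :=
  ∀ (n : ℕ) (s : Iterates E), PartialRun K C f T g P s n →
    s.v n ∈ K ∧
    (∃! x, IsBregmanProj g (T (s.v n)) (s.v n) x) ∧
    ∀ x, IsBregmanProj g (T (s.v n)) (s.v n) x →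
      (zCandidates C f T g (P.β n) (P.e n) (s.v n) x).Nonempty ∧
      ∀ z ∈ zCandidates C f T g (P.β n) (P.e n) (s.v n) x, z ≠ s.v n →
        ∃ l, IsLeast (acceptedExponents C f g P.δ P.θ (P.β n) (P.e n) x z) l ∧
          (∃! w, IsBregmanProj g (cutSet K C f s.y n ∩ cutH C f (trialPoint P.θ x z l)) x w) ∧
          ∀ w, IsBregmanProj g (cutSet K C f s.y n ∩ cutH C f (trialPoint P.θ x z l)) x w →
            ∃! v, IsBregmanProj g (nextSet K g (P.γ n) P.v0 (s.v n) x w) P.v0 v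

/-- The sequences `x^k`, `v^k`, `w^k` are bounded. -/
def BoundedIterates (s : Iterates E) : Prop :=
  IsBounded (range s.x) ∧ IsBounded (range s.v) ∧ IsBounded (range s.w)

end Vector

end

end VQEP

/-! Write D for `bregmanDist g` and let p be a point of Fix(T) that lies in every cut set K_k.
Quasi-nonexpansiveness and the Pythagorean inequality give D(p, w^k) ≤ D(p, x^k) ≤ D(p, v^k), which
places p in L_k and M_k. Membership in N_k is the variational inequality for v^k as a projection of
v^0. A dual solution is such a p, since all y^k lie in K. Hence no set that is projected onto is
empty, and D(v^k, v^0) ≤ D(p, v^0) keeps the iterates bounded (`mem_nextSet`,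
`PartialRun.mem_originCut`).

For a bounded run, N_k makes D(v^k, v^0) increasing with D(v^{k+1}, v^k) bounded by its increments.
Total convexity and the cuts then force v^{k+1} - v^k, v^k - x^k and x^k - w^k to 0
(`Run.tendsto_sub`). A weak limit point of v^k is in Fix(T) by demiclosedness and in K_∞ because w^k
∈ K_k. It is therefore itself an admissible p, and comparing distances to v^0 upgrades weak to
strong convergence and identifies the projection (`Run.tendsto_of_weaklyTendsto`).

The limit is a solution because the linesearch forces D(z^k, x^k) → 0 (`Run.tendsto_bregmanDist_z`),
so weak efficiency of z^k passes to a regularized problem at p. Along segments from p the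
regularization is o(t), so it disappears. Throughout, vanishing errors in Y are absorbed by
multiples of e^k that stay in int C. -/

namespace VQEP

/-! ### Weak compactness and minimization in reflexive spaces. -/

section FunctionalAnalysis

variable {E : Type*} [NormedAddCommGroup E] [NormedSpace ℝ E]

/-- A closed convex set contains the weak limits of the sequences that are eventually in it. -/
theorem WeaklyTendsto.mem_of_isClosed_of_convex {u : ℕ → E} {a : E} (h : WeaklyTendsto u a)
    {A : Set E} (hcl : IsClosed A) (hcv : Convex ℝ A) (hu : ∀ᶠ k in atTop, u k ∈ A) : a ∈ A := by
  by_contra ha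
  obtain ⟨φ, c, h1, h2⟩ := geometric_hahn_banach_point_closed hcv hcl ha
  have : c ≤ φ a := ge_of_tendsto (h φ) (hu.mono fun k hk => (h2 _ hk).le)
  linarith

/-- A separable subspace is separated by countably many functionals. -/
theorem exists_countable_separating_of_separable (M : Submodule ℝ E)
    [TopologicalSpace.SeparableSpace M] :
    ∃ φ : ℕ → StrongDual ℝ E, (∀ n, ‖φ n‖ ≤ 1) ∧ ∀ x ∈ M, (∀ n, φ n x = 0) → x = 0 := by
  choose φ hφ1 hφ2 using fun n => exists_dual_vector'' ℝ (TopologicalSpace.denseSeq M n : E)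
  refine ⟨φ, hφ1, fun x hx h0 => ?_⟩
  rw [← norm_le_zero_iff]
  refine le_of_forall_pos_le_add fun ε hε => ?_
  obtain ⟨n, hn⟩ := (TopologicalSpace.denseRange_denseSeq M).exists_dist_lt ⟨x, hx⟩ (half_pos hε)
  set d : E := (TopologicalSpace.denseSeq M n : E)
  have hd : ‖x - d‖ < ε / 2 := by
    rw [← dist_eq_norm]; exact hn
  have h1 : ‖d‖ ≤ ‖x - d‖ := by
    have h2 : φ n (d - x) = ‖d‖ := by
      rw [map_sub, h0 n, sub_zero]; exact hφ2 n
    calc ‖d‖ = φ n (d - x) := h2.symm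
      _ ≤ ‖φ n (d - x)‖ := le_abs_self _
      _ ≤ 1 * ‖d - x‖ := (φ n).le_of_opNorm_le (hφ1 n) _
      _ = ‖x - d‖ := by rw [one_mul, norm_sub_rev]
  have h2 : ‖x‖ ≤ ‖x - d‖ + ‖d‖ := by simpa using norm_add_le (x - d) d
  linarith

/-- In a reflexive space every bounded sequence has a weakly convergent subsequence. -/
theorem IsReflexive.exists_subseq_weaklyTendsto (hE : IsReflexive E) {u : ℕ → E}
    (hu : IsBounded (range u)) : ∃ (a : E) (ψ : ℕ → ℕ), StrictMono ψ ∧ WeaklyTendsto (u ∘ ψ) a := by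
  obtain ⟨R, hR⟩ : ∃ R, ∀ k, ‖u k‖ ≤ R := by
    obtain ⟨R, hR⟩ := hu.exists_norm_le
    exact ⟨R, fun k => hR _ (mem_range_self k)⟩
  -- On this separable subspace countably many functionals separate points. Once they converge along
  -- a subsequence, all weak-star cluster points in the bidual ball coincide, so compactness gives
  -- convergence.
  let M : Submodule ℝ E := (Submodule.span ℝ (range u)).topologicalClosure
  have huM : ∀ k, u k ∈ M := fun k =>
    Submodule.le_topologicalClosure _ (Submodule.subset_span (mem_range_self k))
  have hMcl : IsClosed (M : Set E) := Submodule.isClosed_topologicalClosure _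
  have hsep : TopologicalSpace.IsSeparable (M : Set E) := by
    have : TopologicalSpace.IsSeparable (range u) := (countable_range u).isSeparable
    exact (this.span (R := ℝ)).closure
  have : TopologicalSpace.SeparableSpace M := hsep.separableSpace
  obtain ⟨φ, hφ1, hφ⟩ := exists_countable_separating_of_separable M
  -- a subsequence along which the countably many functionals converge
  obtain ⟨c, -, ψ, hψ, hc⟩ := (isCompact_univ_pi fun _ : ℕ =>
    isCompact_Icc (a := -R) (b := R)).tendsto_subseq (x := fun k n => φ n (u k)) (by
      intro k n _
      have : ‖φ n (u k)‖ ≤ 1 * ‖u k‖ := (φ n).le_of_opNorm_le (hφ1 n) _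
      exact abs_le.1 (by simpa using this.trans (by simpa using hR k)))
  have hc' : ∀ n, Tendsto (fun k => φ n (u (ψ k))) atTop (𝓝 (c n)) := fun n =>
    (tendsto_pi_nhds.1 hc) n
  let b : ℕ → WeakDual ℝ (StrongDual ℝ E) := fun k =>
    StrongDual.toWeakDual (NormedSpace.inclusionInDoubleDual ℝ E (u (ψ k)))
  let s : Set (WeakDual ℝ (StrongDual ℝ E)) := WeakDual.toStrongDual ⁻¹'
    Metric.closedBall (0 : StrongDual ℝ (StrongDual ℝ E)) R
  have hs : IsCompact s := WeakDual.isCompact_closedBall 0 R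
  have hbs : ∀ k, b k ∈ s := by
    intro k
    change NormedSpace.inclusionInDoubleDual ℝ E (u (ψ k)) ∈
      Metric.closedBall (0 : StrongDual ℝ (StrongDual ℝ E)) R
    exact (mem_closedBall_zero_iff (E := StrongDual ℝ (StrongDual ℝ E))).2
      ((NormedSpace.double_dual_bound ℝ E _).trans (hR _))
  -- evaluation of a cluster point is a cluster point of the evaluations
  have heval : ∀ (ξ : WeakDual ℝ (StrongDual ℝ E)) (χ : StrongDual ℝ E) (r : ℝ),
      MapClusterPt ξ atTop b → Tendsto (fun k => χ (u (ψ k))) atTop (𝓝 r) → ξ χ = r := by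
    intro ξ χ r hξ hr
    have h1 : MapClusterPt (ξ χ) atTop (fun k => b k χ) :=
      hξ.continuousAt_comp (f := fun ζ : WeakDual ℝ (StrongDual ℝ E) => ζ χ)
        (WeakDual.eval_continuous χ).continuousAt
    have h2 : Tendsto (fun k => b k χ) atTop (𝓝 r) := hr
    have : (𝓝 (ξ χ) ⊓ map (fun k => b k χ) atTop).NeBot := h1
    exact tendsto_nhds_unique (f := id)
      (l := 𝓝 (ξ χ) ⊓ map (fun k => b k χ) atTop) inf_le_left (inf_le_right.trans h2)
  have hmem : ∀ a : E, MapClusterPt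
      (StrongDual.toWeakDual (NormedSpace.inclusionInDoubleDual ℝ E a)) atTop b → a ∈ M := by
    intro a ha
    by_contra haM
    obtain ⟨χ, d, h1, h2⟩ := geometric_hahn_banach_point_closed M.convex hMcl haM
    have hz : ∀ x ∈ M, χ x = 0 := by
      intro x hx
      by_contra hne
      -- This multiple of x would give χ the value d - 1, below its bound d on M.
      have := h2 (((d - 1) / χ x) • x) (M.smul_mem _ hx)
      rw [map_smul, smul_eq_mul, div_mul_cancel₀ _ hne] at this
      linarith
    have h3 : χ a = 0 := heval _ χ 0 ha
      (tendsto_const_nhds.congr fun k => (hz _ (huM _)).symm)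
    have h4 := h2 0 M.zero_mem
    rw [map_zero] at h4
    linarith
  obtain ⟨ξ, -, hξ⟩ := hs.exists_mapClusterPt (f := atTop) (u := b)
    (tendsto_principal.2 (Eventually.of_forall hbs))
  obtain ⟨a, rfl⟩ : ∃ a, StrongDual.toWeakDual (NormedSpace.inclusionInDoubleDual ℝ E a) = ξ := by
    obtain ⟨a, ha⟩ := hE (WeakDual.toStrongDual ξ)
    exact ⟨a, by rw [ha]; rfl⟩
  have huniq : ∀ η ∈ s, MapClusterPt η atTop b →
      η = StrongDual.toWeakDual (NormedSpace.inclusionInDoubleDual ℝ E a) := by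
    intro η _ hη
    obtain ⟨a', rfl⟩ : ∃ a', StrongDual.toWeakDual (NormedSpace.inclusionInDoubleDual ℝ E a') = η := by
      obtain ⟨a', ha'⟩ := hE (WeakDual.toStrongDual η)
      exact ⟨a', by rw [ha']; rfl⟩
    have : a' - a = 0 := hφ _ (M.sub_mem (hmem _ hη) (hmem _ hξ)) fun n => by
      have h1 : φ n a' = c n := heval _ (φ n) _ hη (hc' n)
      have h2 : φ n a = c n := heval _ (φ n) _ hξ (hc' n)
      rw [map_sub, h1, h2, sub_self]
    rw [sub_eq_zero.1 this]
  have hlim := hs.tendsto_nhds_of_unique_mapClusterPt (Eventually.of_forall hbs) huniq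
  exact ⟨a, ψ, hψ, fun χ => ((WeakDual.eval_continuous χ).tendsto _).comp hlim⟩

/-- In a reflexive space, a convex continuous function with bounded sublevel sets attains its
minimum on every nonempty closed convex set. -/
theorem IsReflexive.exists_isMinOn (hE : IsReflexive E) {h : E → ℝ} (hcv : ConvexOn ℝ univ h)
    (hct : Continuous h) (hbd : ∀ r, IsBounded {x | h x ≤ r}) {A : Set E} (hAne : A.Nonempty)
    (hAcl : IsClosed A) (hAcv : Convex ℝ A) : ∃ a ∈ A, ∀ y ∈ A, h a ≤ h y := by
  have hsub : ∀ r, Convex ℝ (A ∩ {x | h x ≤ r}) := fun r => by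
    simpa using hAcv.inter (hcv.convex_le r)
  have hclosed : ∀ r, IsClosed (A ∩ {x | h x ≤ r}) := fun r =>
    hAcl.inter (isClosed_le hct continuous_const)
  -- Used twice: with r n = -n to show that h is bounded below on A, and with r n decreasing to the
  -- infimum to produce a minimizer.
  have hkey : ∀ (u : ℕ → E) (r : ℕ → ℝ), Antitone r → (∀ n, u n ∈ A) → (∀ n, h (u n) ≤ r n) →
      ∃ a ∈ A, ∀ n, h a ≤ r n := by
    intro u r hr huA hur
    obtain ⟨a, ψ, hψ, ha⟩ := hE.exists_subseq_weaklyTendsto (u := u) ((hbd (r 0)).subset (by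
      rintro _ ⟨n, rfl⟩
      exact (hur n).trans (hr n.zero_le)))
    have : ∀ n, a ∈ A ∩ {x | h x ≤ r n} := fun n =>
      ha.mem_of_isClosed_of_convex (hclosed _) (hsub _) (by
        filter_upwards [eventually_ge_atTop n] with k hk
        exact ⟨huA _, (hur _).trans (hr (hk.trans (hψ.id_le k)))⟩)
    exact ⟨a, (this 0).1, fun n => (this n).2⟩
  obtain ⟨a0, ha0⟩ := hAne
  have hbdd : BddBelow (h '' A) := by
    by_contra hnb
    have : ∀ n : ℕ, ∃ x ∈ A, h x ≤ -(n : ℝ) := by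
      intro n
      by_contra! hn
      exact hnb ⟨-(n : ℝ), by rintro _ ⟨x, hx, rfl⟩; exact (hn x hx).le⟩
    choose u huA hu using this
    obtain ⟨a, -, ha⟩ := hkey u (fun n => -(n : ℝ))
      (fun m n hmn => neg_le_neg (Nat.cast_le.2 hmn)) huA hu
    obtain ⟨n, hn⟩ := exists_nat_gt (-h a)
    linarith [ha n]
  have : ∀ n : ℕ, ∃ x ∈ A, h x ≤ sInf (h '' A) + 1 / ((n : ℝ) + 1) := by
    intro n
    obtain ⟨_, ⟨x, hx, rfl⟩, hlt⟩ := exists_lt_of_csInf_lt (s := h '' A) ⟨_, a0, ha0, rfl⟩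
      (lt_add_of_pos_right (sInf (h '' A)) (by positivity : 0 < 1 / ((n : ℝ) + 1)))
    exact ⟨x, hx, hlt.le⟩
  choose u huA hu using this
  obtain ⟨a, haA, ha⟩ := hkey u _ (fun m n hmn => by gcongr) huA hu
  have hlim : Tendsto (fun n : ℕ => sInf (h '' A) + 1 / ((n : ℝ) + 1)) atTop
      (𝓝 (sInf (h '' A) + 0)) := tendsto_const_nhds.add tendsto_one_div_add_atTop_nhds_zero_nat
  have hle : h a ≤ sInf (h '' A) := by simpa using ge_of_tendsto' hlim ha
  exact ⟨a, haA, fun y hy => hle.trans (csInf_le hbdd ⟨y, hy, rfl⟩)⟩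

/-- A map that is uniformly continuous on bounded sets maps bounded sets to bounded sets. -/
theorem isBounded_image_of_uniformContinuousOn {W : Type*} [PseudoMetricSpace W] {F : E → W}
    (hF : ∀ A, IsBounded A → UniformContinuousOn F A) {A : Set E} (hA : IsBounded A) :
    IsBounded (F '' A) := by
  obtain ⟨R, hR0, hR⟩ := hA.subset_closedBall_lt 0 0
  obtain ⟨δ, hδ, h⟩ := Metric.uniformContinuousOn_iff.1
    (hF _ (Metric.isBounded_closedBall (x := (0 : E)) (r := R))) 1 one_pos
  -- The segment from 0 to any x in the ball splits into n pieces shorter than δ, and F moves by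
  -- less than 1 on each.
  obtain ⟨n, hn⟩ := exists_nat_gt (R / δ)
  have hn0 : (0 : ℝ) < n := lt_trans (by positivity) hn
  refine (Metric.isBounded_iff_subset_closedBall (F 0)).2 ⟨n, ?_⟩
  rintro _ ⟨x, hx, rfl⟩
  have hxR : ‖x‖ ≤ R := by simpa using hR hx
  have hp : ∀ i : ℕ, i ≤ n → ((i : ℝ) / n) • x ∈ Metric.closedBall (0 : E) R := by
    intro i hi
    rw [mem_closedBall_zero_iff, norm_smul, Real.norm_of_nonneg (by positivity)]
    have : (i : ℝ) / n ≤ 1 := (div_le_one hn0).2 (Nat.cast_le.2 hi)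
    nlinarith [norm_nonneg x]
  have hstep : ∀ i : ℕ, i ≤ n → dist (F (((i : ℝ) / n) • x)) (F 0) ≤ i := by
    intro i
    induction i with
    | zero => intro _; simp
    | succ i ih =>
      intro hi
      have h1 : dist (F (((i + 1 : ℕ) / n : ℝ) • x)) (F (((i : ℝ) / n) • x)) < 1 := by
        refine h _ (hp _ hi) _ (hp _ (by omega)) ?_
        rw [dist_eq_norm, ← sub_smul, norm_smul]
        have : ((i + 1 : ℕ) / n : ℝ) - (i : ℝ) / n = 1 / n := by push_cast; ring
        rw [this, Real.norm_of_nonneg (by positivity), one_div_mul_eq_div, div_lt_iff₀ hn0]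
        rw [div_lt_iff₀ hδ] at hn
        linarith
      have h2 := dist_triangle (F (((i + 1 : ℕ) / n : ℝ) • x)) (F (((i : ℝ) / n) • x)) (F 0)
      have h3 := ih (by omega)
      push_cast at *
      linarith
  have := hstep n le_rfl
  rwa [div_self hn0.ne', one_smul] at this

end FunctionalAnalysis

/-! ### Uniform continuity on bounded sets. -/

section UniformContinuity

variable {E : Type*} [SeminormedAddCommGroup E]

theorem continuous_of_uniformContinuousOn_isBounded {W : Type*} [PseudoMetricSpace W] {F : E → W}
    (hF : ∀ A, IsBounded A → UniformContinuousOn F A) : Continuous F :=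
  continuous_iff_continuousAt.2 fun x =>
    (hF _ (Metric.isBounded_ball (x := x) (r := 1))).continuousOn.continuousAt
      (Metric.ball_mem_nhds x one_pos)

/-- Uniform continuity on bounded sets, along a filter. -/
theorem tendsto_sub_of_uniformContinuousOn {W ι : Type*} [SeminormedAddCommGroup W] {F : E → W}
    (hF : ∀ A, IsBounded A → UniformContinuousOn F A) {l : Filter ι} {a b : ι → E}
    (ha : IsBounded (range a)) (hb : IsBounded (range b))
    (h : Tendsto (fun i => a i - b i) l (𝓝 0)) : Tendsto (fun i => F (a i) - F (b i)) l (𝓝 0) := by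
  rw [Metric.tendsto_nhds] at h ⊢
  intro ε hε
  obtain ⟨δ, hδ, H⟩ := Metric.uniformContinuousOn_iff.1 (hF _ (ha.union hb)) ε hε
  filter_upwards [h δ hδ] with i hi
  rw [dist_zero_right, ← dist_eq_norm] at hi ⊢
  exact H _ (Or.inl (mem_range_self i)) _ (Or.inr (mem_range_self i)) hi

end UniformContinuity

/-! ### Bregman distances and projections. -/

section BregmanDistance

variable {E : Type*} [NormedAddCommGroup E] [NormedSpace ℝ E] {g : E → ℝ}

theorem IsBregmanFunction.hasGateauxDerivAt (hg : IsBregmanFunction g) (x : E) :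
    HasGateauxDerivAt g (gateauxDeriv g x) x := by
  have h := hg.gateaux x
  rw [gateauxDeriv, dif_pos h]
  exact h.choose_spec

@[simp] theorem bregmanDist_self (g : E → ℝ) (x : E) : bregmanDist g x x = 0 := by
  simp [bregmanDist]

/-- The three-point identity. -/
theorem bregmanDist_three_point (g : E → ℝ) (z p x : E) :
    bregmanDist g z x = bregmanDist g z p + bregmanDist g p x
      + (gateauxDeriv g p - gateauxDeriv g x) (z - p) := by
  simp only [bregmanDist, sub_apply, map_sub]
  ring

theorem bregmanDist_add_bregmanDist (g : E → ℝ) (x y : E) :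
    bregmanDist g x y + bregmanDist g y x = (gateauxDeriv g x - gateauxDeriv g y) (x - y) := by
  simp only [bregmanDist, sub_apply, map_sub]
  ring

/-- On the line from y to x, the slope of a convex function over [0, 1] is at least its derivative
at 0. -/
theorem IsBregmanFunction.bregmanDist_nonneg (hg : IsBregmanFunction g) (x y : E) :
    0 ≤ bregmanDist g x y := by
  have hd : HasDerivAt (fun t : ℝ => g (y + t • (x - y))) (gateauxDeriv g y (x - y)) 0 :=
    hg.hasGateauxDerivAt y (x - y)
  have hc : ConvexOn ℝ univ (fun t : ℝ => g (y + t • (x - y))) := by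
    have := hg.strictConvex.convexOn.comp_affineMap (AffineMap.lineMap y x : ℝ →ᵃ[ℝ] E)
    refine this.congr fun t _ => ?_
    simp [AffineMap.lineMap_apply, add_comm]
  have := hc.le_slope_of_hasDerivAt (mem_univ 0) (mem_univ 1) one_pos hd
  rw [slope_def_field] at this
  simp only [bregmanDist]
  simp only [zero_smul, one_smul, add_zero, sub_zero, div_one, add_sub_cancel] at this
  linarith

/-- Strict convexity of `D_g(·, x)`. -/
theorem IsBregmanFunction.strictConvexOn_bregmanDist (hg : IsBregmanFunction g) (x : E) :
    StrictConvexOn ℝ univ (fun y => bregmanDist g y x) := by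
  refine ⟨convex_univ, fun y hy z hz hyz a b ha hb hab => ?_⟩
  have h := hg.strictConvex.2 hy hz hyz ha hb hab
  simp only [bregmanDist, map_sub, map_add, map_smul, smul_eq_mul] at h ⊢
  have hb' : b = 1 - a := by linarith
  subst hb'
  linarith

/-- At the midpoint m of x and y, strict convexity gives 0 ≤ D(m, y) < D(x, y) / 2. -/
theorem IsBregmanFunction.bregmanDist_pos (hg : IsBregmanFunction g) {x y : E} (h : x ≠ y) :
    0 < bregmanDist g x y := by
  have h1 := (hg.strictConvexOn_bregmanDist y).2 (mem_univ x) (mem_univ y) h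
    (one_half_pos (α := ℝ)) one_half_pos (add_halves 1)
  have h2 := hg.bregmanDist_nonneg ((1 / 2 : ℝ) • x + (1 / 2 : ℝ) • y) y
  simp only [bregmanDist_self, smul_eq_mul, mul_zero, add_zero] at h1
  linarith

/-- `D_g(p + t d, p) = o(t)` as `t ↓ 0`. -/
theorem IsBregmanFunction.tendsto_bregmanDist_div (hg : IsBregmanFunction g) (p d : E) :
    Tendsto (fun t : ℝ => bregmanDist g (p + t • d) p / t) (𝓝[>] 0) (𝓝 0) := by
  have hd : HasDerivAt (fun t : ℝ => g (p + t • d)) (gateauxDeriv g p d) 0 :=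
    hg.hasGateauxDerivAt p d
  have h := hd.tendsto_slope_zero_right.sub_const
    (gateauxDeriv g p d)
  rw [sub_self] at h
  refine h.congr' ?_
  filter_upwards [self_mem_nhdsWithin] with t (ht : 0 < t)
  simp only [bregmanDist, zero_add, zero_smul, add_zero, smul_eq_mul, add_sub_cancel_left, map_smul]
  field_simp

/-- The variational inequality for Bregman projections. -/
theorem IsBregmanFunction.variational_of_isBregmanProj (hg : IsBregmanFunction g) {A : Set E}
    (hA : Convex ℝ A) {x p z : E} (hp : IsBregmanProj g A x p) (hz : z ∈ A) :
    (gateauxDeriv g x - gateauxDeriv g p) (z - p) ≤ 0 := by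
  have hlim := (hg.tendsto_bregmanDist_div p (z - p)).add_const
    ((gateauxDeriv g p - gateauxDeriv g x) (z - p))
  have hnn : 0 ≤ 0 + (gateauxDeriv g p - gateauxDeriv g x) (z - p) := by
    refine ge_of_tendsto hlim ?_
    filter_upwards [self_mem_nhdsWithin, Ioo_mem_nhdsGT (zero_lt_one' ℝ)] with t (ht : 0 < t) ht1
    -- Minimality of p is tested at this point; the three-point identity is divided by t, and D(p +
    -- t(z - p), p) / t vanishes as t ↓ 0.
    have hmem : p + t • (z - p) ∈ A := hA.add_smul_sub_mem hp.1 hz ⟨ht.le, ht1.2.le⟩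
    have h1 := hp.2 _ hmem
    rw [bregmanDist_three_point g (p + t • (z - p)) p x, add_sub_cancel_left, map_smul,
      smul_eq_mul] at h1
    have h2 : 0 ≤ (bregmanDist g (p + t • (z - p)) p
        + t * (gateauxDeriv g p - gateauxDeriv g x) (z - p)) / t := div_nonneg (by linarith) ht.le
    rwa [add_div, mul_div_cancel_left₀ _ ht.ne'] at h2
  simp only [sub_apply] at hnn ⊢
  linarith

/-- The Pythagorean inequality for Bregman projections. -/
theorem IsBregmanFunction.pythagoras (hg : IsBregmanFunction g) {A : Set E}
    (hA : Convex ℝ A) {x p z : E} (hp : IsBregmanProj g A x p) (hz : z ∈ A) :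
    bregmanDist g z p + bregmanDist g p x ≤ bregmanDist g z x := by
  have h := hg.variational_of_isBregmanProj hA hp hz
  rw [bregmanDist_three_point g z p x]
  simp only [sub_apply] at h ⊢
  linarith

theorem IsBregmanFunction.isBregmanProj_unique (hg : IsBregmanFunction g) {A : Set E}
    (hA : Convex ℝ A) {x p q : E} (hp : IsBregmanProj g A x p) (hq : IsBregmanProj g A x q) :
    p = q := by
  by_contra hne
  have h1 := hg.pythagoras hA hp hq.1
  have h2 := hg.bregmanDist_pos (Ne.symm hne)
  have h3 := hq.2 p hp.1
  linarith

theorem IsBregmanFunction.isBregmanProj_self_of_mem (hg : IsBregmanFunction g) {A : Set E} {x : E}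
    (hx : x ∈ A) : IsBregmanProj g A x x :=
  ⟨hx, fun y _ => by simpa using hg.bregmanDist_nonneg y x⟩

/-- The gradient inequality in both directions squeezes g(x) between g(y) + ⟨x - y, g'(y)⟩ and g(y)
+ ⟨x - y, g'(x)⟩, and g' is continuous. -/
theorem IsBregmanFunction.continuous (hg : IsBregmanFunction g) (h3 : H3 g) : Continuous g := by
  have hc : Continuous (gateauxDeriv g) := continuous_of_uniformContinuousOn_isBounded h3
  refine continuous_iff_continuousAt.2 fun y => ?_
  have hlow : Tendsto (fun x => g y + gateauxDeriv g y (x - y)) (𝓝 y) (𝓝 (g y)) := by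
    have : Continuous fun x => g y + gateauxDeriv g y (x - y) := by fun_prop
    simpa using this.tendsto y
  have hup : Tendsto (fun x => g y + gateauxDeriv g x (x - y)) (𝓝 y) (𝓝 (g y)) := by
    have : Continuous fun x => g y + gateauxDeriv g x (x - y) := by fun_prop
    simpa using this.tendsto y
  refine tendsto_of_tendsto_of_tendsto_of_le_of_le hlow hup (fun x => ?_) fun x => ?_
  · have := hg.bregmanDist_nonneg x y
    simp only [bregmanDist] at this ⊢
    linarith
  · have := hg.bregmanDist_nonneg y x
    simp only [bregmanDist, map_sub] at this ⊢
    linarith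

theorem IsBregmanFunction.continuous_bregmanDist (hg : IsBregmanFunction g) (h3 : H3 g) (x : E) :
    Continuous fun y => bregmanDist g y x := by
  have := hg.continuous h3
  unfold bregmanDist
  fun_prop

theorem exists_norm_gateauxDeriv_le (h3 : H3 g) {A : Set E} (hA : IsBounded A) :
    ∃ M, 0 ≤ M ∧ ∀ x ∈ A, ‖gateauxDeriv g x‖ ≤ M := by
  obtain ⟨M, hM⟩ := (isBounded_image_of_uniformContinuousOn h3 hA).exists_norm_le
  exact ⟨max M 0, le_max_right _ _, fun x hx => (hM _ (mem_image_of_mem _ hx)).trans (le_max_left _ _)⟩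

/-- `D_g` is bounded on bounded sets. -/
theorem IsBregmanFunction.exists_bregmanDist_le (hg : IsBregmanFunction g) (h3 : H3 g) {A : Set E}
    (hA : IsBounded A) : ∃ M, ∀ x ∈ A, ∀ y ∈ A, bregmanDist g x y ≤ M := by
  obtain ⟨M, hM0, hM⟩ := exists_norm_gateauxDeriv_le h3 hA
  obtain ⟨R, hR⟩ := hA.exists_norm_le
  refine ⟨(M + M) * (R + R), fun x hx y hy => ?_⟩
  -- In the symmetrized distance the values of g cancel, so bounds on g' suffice.
  have h1 := bregmanDist_add_bregmanDist g x y
  have h2 := hg.bregmanDist_nonneg y x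
  have h4 : ‖(gateauxDeriv g x - gateauxDeriv g y) (x - y)‖ ≤ (M + M) * (R + R) :=
    ((gateauxDeriv g x - gateauxDeriv g y).le_opNorm _).trans (mul_le_mul
      ((norm_sub_le _ _).trans (add_le_add (hM x hx) (hM y hy)))
      ((norm_sub_le _ _).trans (add_le_add (hR x hx) (hR y hy))) (norm_nonneg _) (by positivity))
  have h5 := le_abs_self ((gateauxDeriv g x - gateauxDeriv g y) (x - y))
  rw [Real.norm_eq_abs] at h4
  linarith

/-- Coercivity: `g` dominates every affine function of the norm. -/
theorem H4.isBounded_setOf_le (h4 : H4 g) (a b : ℝ) : IsBounded {x : E | g x ≤ a * ‖x‖ + b} := by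
  -- The maximum with 1 supplies the positive slope that H4 requires.
  have h := h4 0 (max a 1) (by positivity)
  have hev := h.eventually (eventually_gt_atTop b)
  rw [comap_norm_atTop] at hev
  have : IsBounded {x : E | ¬ b < g x - max a 1 * ‖x - 0‖} := by
    rw [isBounded_def]
    filter_upwards [hev] with x hx
    exact not_not.2 hx
  refine this.subset fun x hx => ?_
  simp only [mem_ofPred_eq, sub_zero, not_lt] at hx ⊢
  nlinarith [le_max_left a 1, norm_nonneg x]

theorem isBounded_setOf_bregmanDist_le (h4 : H4 g) (x : E) (r : ℝ) :
    IsBounded {y | bregmanDist g y x ≤ r} := by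
  refine (h4.isBounded_setOf_le ‖gateauxDeriv g x‖ (r + g x - gateauxDeriv g x x)).subset
    fun y hy => ?_
  simp only [mem_ofPred_eq, bregmanDist, map_sub] at hy ⊢
  have := (le_abs_self _).trans ((gateauxDeriv g x).le_opNorm y)
  linarith

theorem IsBregmanFunction.existsUnique_isBregmanProj (hg : IsBregmanFunction g)
    (hE : IsReflexive E) (h3 : H3 g) (h4 : H4 g) {A : Set E} (hne : A.Nonempty) (hcl : IsClosed A)
    (hcv : Convex ℝ A) (x : E) : ∃! p, IsBregmanProj g A x p := by
  obtain ⟨p, hpA, hp⟩ := hE.exists_isMinOn (hg.strictConvexOn_bregmanDist x).convexOn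
    (hg.continuous_bregmanDist h3 x) (isBounded_setOf_bregmanDist_le h4 x) hne hcl hcv
  exact ⟨p, ⟨hpA, hp⟩, fun q hq => hg.isBregmanProj_unique hcv hq ⟨hpA, hp⟩⟩

/-- On bounded sets, `D_g(y, x)` is bounded away from zero when `‖y - x‖` is. -/
theorem IsBregmanFunction.exists_le_bregmanDist (hg : IsBregmanFunction g) (h2 : H2 g) {A : Set E}
    (hA : IsBounded A) {t : ℝ} (ht : 0 < t) :
    ∃ c > 0, ∀ x ∈ A, ∀ y, t ≤ ‖y - x‖ → c ≤ bregmanDist g y x := by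
  obtain ⟨c, hc0, hc⟩ := EReal.lt_iff_exists_real_btwn.1 (h2 A hA t ht)
  refine ⟨c, by exact_mod_cast hc0, fun x hx y hxy => ?_⟩
  have hn : 0 < ‖y - x‖ := ht.trans_le hxy
  -- The modulus only sees the sphere of radius t, so y is pulled back to it along the segment; by
  -- convexity this multiplies D(·, x) by at most s ≤ 1.
  set s := t / ‖y - x‖ with hs
  have hs0 : 0 ≤ s := by positivity
  have hs1 : s ≤ 1 := (div_le_one hn).2 hxy
  have hu : ‖(s • y + (1 - s) • x) - x‖ = t := by
    have : (s • y + (1 - s) • x) - x = s • (y - x) := by module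
    rw [this, norm_smul, Real.norm_of_nonneg hs0, hs, div_mul_cancel₀ _ hn.ne']
  have h1 : (c : EReal) ≤ bregmanDist g (s • y + (1 - s) • x) x :=
    hc.le.trans ((iInf₂_le x hx).trans (iInf_le (fun u : {u : E // ‖u - x‖ = t} =>
      (bregmanDist g u.1 x : EReal)) ⟨_, hu⟩))
  have h1' : c ≤ bregmanDist g (s • y + (1 - s) • x) x := by exact_mod_cast h1
  have h2 := (hg.strictConvexOn_bregmanDist x).convexOn.2 (mem_univ y) (mem_univ x) hs0
    (sub_nonneg.2 hs1) (by ring)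
  simp only [bregmanDist_self, smul_eq_mul, mul_zero, add_zero] at h2
  nlinarith [hg.bregmanDist_nonneg y x]

theorem IsBregmanFunction.tendsto_sub_of_tendsto_bregmanDist (hg : IsBregmanFunction g) (h2 : H2 g)
    {ι : Type*} {l : Filter ι} {a b : ι → E} (hb : IsBounded (range b))
    (h : Tendsto (fun i => bregmanDist g (a i) (b i)) l (𝓝 0)) :
    Tendsto (fun i => a i - b i) l (𝓝 0) := by
  rw [Metric.tendsto_nhds]
  intro t ht
  obtain ⟨c, hc, H⟩ := hg.exists_le_bregmanDist h2 hb ht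
  filter_upwards [h.eventually (gt_mem_nhds hc)] with i hi
  rw [dist_zero_right]
  by_contra! hle
  linarith [H (b i) (mem_range_self i) (a i) hle]

end BregmanDistance

/-! ### The ordering cone and its interior. -/

section OrderingCone

variable {Y : Type*} [NormedAddCommGroup Y] [NormedSpace ℝ Y] {C : ProperCone ℝ Y}

theorem smul_mem_cone {t : ℝ} (ht : 0 ≤ t) {a : Y} (ha : a ∈ C) : t • a ∈ C :=
  C.smul_mem ha ht

theorem add_mem_interior {a b : Y} (ha : a ∈ interior (C : Set Y)) (hb : b ∈ C) :
    a + b ∈ interior (C : Set Y) := by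
  refine interior_mono ?_ (subset_interior_add_left (add_mem_add ha (show b ∈ (C : Set Y) from hb)))
  rintro _ ⟨x, hx, y, hy, rfl⟩
  exact C.add_mem hx hy

theorem smul_mem_interior {t : ℝ} (ht : 0 < t) {a : Y} (ha : a ∈ interior (C : Set Y)) :
    t • a ∈ interior (C : Set Y) := by
  refine interior_maximal (s := (C : Set Y)) (t := (fun u => t • u) '' interior (C : Set Y)) ?_
    ((Homeomorph.smulOfNeZero t ht.ne').isOpenMap _ isOpen_interior) (mem_image_of_mem _ ha)
  rintro _ ⟨x, hx, rfl⟩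
  exact C.smul_mem (interior_subset hx) ht.le

theorem smul_mem_interior_iff {t : ℝ} (ht : 0 < t) {a : Y} :
    t • a ∈ interior (C : Set Y) ↔ a ∈ interior (C : Set Y) := by
  refine ⟨fun h => ?_, smul_mem_interior ht⟩
  simpa [smul_smul, inv_mul_cancel₀ ht.ne'] using smul_mem_interior (inv_pos.2 ht) h

theorem IsOrderingCone.exists_notMem [Nontrivial Y] (hC : IsOrderingCone C) : ∃ u : Y, u ∉ C := by
  obtain ⟨u, hu⟩ := exists_ne (0 : Y)
  by_contra! h
  exact hu (hC.pointed u (h u) (h (-u)))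

/-- A cone with 0 in its interior is the whole space, which a pointed cone in a nontrivial space is
not. -/
theorem IsOrderingCone.zero_notMem_interior [Nontrivial Y] (hC : IsOrderingCone C) :
    (0 : Y) ∉ interior (C : Set Y) := by
  intro h0
  obtain ⟨u, hu⟩ := hC.exists_notMem
  have hlim : Tendsto (fun t : ℝ => t • u) (𝓝[>] 0) (𝓝 (0 : Y)) := by
    have : Continuous fun t : ℝ => t • u := by fun_prop
    simpa using (this.tendsto 0).mono_left nhdsWithin_le_nhds
  obtain ⟨t, ht, ht0⟩ := ((hlim.eventually (isOpen_interior.mem_nhds h0)).and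
    self_mem_nhdsWithin).exists
  exact hu (interior_subset ((smul_mem_interior_iff ht0).1 ht))

/-- There is a functional that is nonnegative on `C` and positive on the interior of `C`. -/
theorem IsOrderingCone.exists_pos_functional [Nontrivial Y] (hC : IsOrderingCone C) :
    ∃ φ : StrongDual ℝ Y, (∀ u ∈ C, 0 ≤ φ u) ∧ ∀ u ∈ interior (C : Set Y), 0 < φ u := by
  obtain ⟨u, hu⟩ := hC.exists_notMem
  obtain ⟨φ, hφ, hφu⟩ := C.hyperplane_separation_point hu
  refine ⟨φ, hφ, fun a ha => (hφ a (interior_subset ha)).lt_of_ne fun h0 => ?_⟩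
  -- If φ a = 0, a small move from the interior point a towards u stays in C but makes φ negative.
  have hlim : Tendsto (fun t : ℝ => a + t • u) (𝓝[>] 0) (𝓝 a) := by
    have : Continuous fun t : ℝ => a + t • u := by fun_prop
    simpa using (this.tendsto 0).mono_left nhdsWithin_le_nhds
  obtain ⟨t, ht, ht0⟩ := ((hlim.eventually (isOpen_interior.mem_nhds ha)).and
    self_mem_nhdsWithin).exists
  have := hφ _ (interior_subset ht)
  rw [map_add, map_smul, ← h0, smul_eq_mul, zero_add] at this
  exact absurd this (not_le.2 (mul_neg_of_pos_of_neg ht0 hφu))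

/-- If `q_i ∈ C`, `r_i → 0`, `e_i → e ∈ int C` and `s_i ≥ η > 0`, then eventually
`q_i + r_i + s_i e_i ∈ int C`. -/
theorem eventually_add_mem_interior {ι : Type*} {l : Filter ι} {q r e : ι → Y} {s : ι → ℝ}
    {ebar : Y} {η : ℝ} (hη : 0 < η) (hq : ∀ i, q i ∈ C) (hr : Tendsto r l (𝓝 0))
    (he : Tendsto e l (𝓝 ebar)) (hebar : ebar ∈ interior (C : Set Y))
    (heC : ∀ i, e i ∈ interior (C : Set Y)) (hs : ∀ᶠ i in l, η ≤ s i) :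
    ∀ᶠ i in l, q i + r i + s i • e i ∈ interior (C : Set Y) := by
  -- Only the part η of s_i absorbs the error; the remainder (s_i - η) e_i is in C, so s_i need not
  -- converge or be bounded.
  have h1 : Tendsto (fun i => r i + η • e i) l (𝓝 (0 + η • ebar)) := hr.add (he.const_smul η)
  rw [zero_add] at h1
  filter_upwards [h1.eventually (isOpen_interior.mem_nhds (smul_mem_interior hη hebar)), hs]
    with i hi hsi
  have h2 := add_mem_interior (add_mem_interior hi (hq i))
    (smul_mem_cone (sub_nonneg.2 hsi) (interior_subset (heC i)))
  have h3 : q i + r i + s i • e i = r i + η • e i + q i + (s i - η) • e i := by module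
  rwa [h3]

theorem notMem_interior_of_tendsto {ι : Type*} {l : Filter ι} [l.NeBot] {q : ι → Y} {a : Y}
    (h : Tendsto q l (𝓝 a)) (hq : ∀ᶠ i in l, q i ∉ interior (C : Set Y)) :
    a ∉ interior (C : Set Y) := fun ha => by
  obtain ⟨i, hi, hi'⟩ := ((h.eventually (isOpen_interior.mem_nhds ha)).and hq).exists
  exact hi' hi

end OrderingCone

/-! ### The vector bifunction, the subproblem and the linesearch. -/

section VectorBifunction

variable {E Y : Type*} [NormedAddCommGroup E] [NormedSpace ℝ E]
  [NormedAddCommGroup Y] [NormedSpace ℝ Y] {C : ProperCone ℝ Y} {f : E → E → Y} {g : E → ℝ}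

theorem B2.continuous (hB2 : B2 f) : Continuous fun q : E × E => f q.1 q.2 :=
  continuous_of_uniformContinuousOn_isBounded hB2

theorem B2.continuous_right (hB2 : B2 f) (x : E) : Continuous (f x) :=
  hB2.continuous.comp (Continuous.prodMk_right x)

theorem isBounded_range_prodMk {ι : Type*} {a b : ι → E} (ha : IsBounded (range a))
    (hb : IsBounded (range b)) : IsBounded (range fun i => (a i, b i)) :=
  (ha.prod hb).subset (by rintro _ ⟨i, rfl⟩; exact ⟨mem_range_self i, mem_range_self i⟩)

/-- Uniform continuity of `f` on bounded sets, along a filter. -/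
theorem B2.tendsto_sub (hB2 : B2 f) {ι : Type*} {l : Filter ι} {a a' b b' : ι → E}
    (ha : IsBounded (range a)) (ha' : IsBounded (range a')) (hb : IsBounded (range b))
    (hb' : IsBounded (range b')) (h : Tendsto (fun i => a i - a' i) l (𝓝 0))
    (h' : Tendsto (fun i => b i - b' i) l (𝓝 0)) :
    Tendsto (fun i => f (a i) (b i) - f (a' i) (b' i)) l (𝓝 0) :=
  tendsto_sub_of_uniformContinuousOn hB2 (a := fun i => (a i, b i)) (b := fun i => (a' i, b' i))
    (isBounded_range_prodMk ha hb) (isBounded_range_prodMk ha' hb') (h.prodMk_nhds h')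

theorem isClosed_cutH (hB2 : B2 f) (y : E) : IsClosed (cutH C f y) :=
  C.isClosed.preimage (hB2.continuous_right y).neg

theorem convex_cutH (hB3 : B3 C f) (y : E) : Convex ℝ (cutH C f y) := by
  intro a ha b hb s t hs ht hst
  obtain rfl : t = 1 - s := by linarith
  have h1 := hB3 y a b s hs (by linarith)
  have h2 := C.add_mem h1 (C.add_mem (smul_mem_cone hs ha) (smul_mem_cone ht hb))
  change -f y _ ∈ C
  have h3 : -f y (s • a + (1 - s) • b) = s • f y a + (1 - s) • f y b - f y (s • a + (1 - s) • b)
      + (s • -f y a + (1 - s) • -f y b) := by module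
  rw [h3]
  exact h2

theorem isClosed_cutSet (hB2 : B2 f) {K : Set E} (hK : IsClosed K) (y : ℕ → E) (k : ℕ) :
    IsClosed (cutSet K C f y k) := by
  induction k with
  | zero => exact hK
  | succ k ih => exact ih.inter (isClosed_cutH hB2 _)

theorem convex_cutSet (hB3 : B3 C f) {K : Set E} (hK : Convex ℝ K) (y : ℕ → E) (k : ℕ) :
    Convex ℝ (cutSet K C f y k) := by
  induction k with
  | zero => exact hK
  | succ k ih => exact ih.inter (convex_cutH hB3 _)

theorem cutSet_antitone (K : Set E) (C : ProperCone ℝ Y) (f : E → E → Y) (y : ℕ → E) :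
    Antitone (cutSet K C f y) :=
  antitone_nat_of_succ_le fun _ => inter_subset_left

/-- Weak efficiency of `z^k`, compared with a point `s` of `T(v^k)`. -/
theorem notMem_interior_of_mem_zCandidates {T : E → Set E} {β : ℝ} {e : Y} {v x z s : E}
    (hz : z ∈ zCandidates C f T g β e v x) (hs : s ∈ T v) :
    β • f x z - β • f x s + (g z - g s - gateauxDeriv g x (z - s)) • e ∉ interior (C : Set Y) := by
  have h := hz.2 s hs
  convert h using 2
  rw [map_sub]
  module

/-- Comparison of `z^k` with `x^k`. -/
theorem notMem_interior_of_mem_zCandidates_self {T : E → Set E} (hB1 : B1 f) {β : ℝ} {e : Y}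
    {v x z : E} (hz : z ∈ zCandidates C f T g β e v x) (hx : x ∈ T v) :
    β • f x z + bregmanDist g z x • e ∉ interior (C : Set Y) := by
  have h := notMem_interior_of_mem_zCandidates hz hx
  rwa [hB1, smul_zero, sub_zero] at h

/-- Scalarization: the subproblem for `z^k` is solvable. -/
theorem zCandidates_nonempty [Nontrivial Y] (hC : IsOrderingCone C) (hE : IsReflexive E)
    (hB2 : B2 f) (hB3 : B3 C f) (hg : IsBregmanFunction g) (h3 : H3 g) (h4 : H4 g)
    {T : E → Set E} {β : ℝ} (hβ : 0 ≤ β) {e : Y} (he : e ∈ interior (C : Set Y)) {v x : E}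
    (hne : (T v).Nonempty) (hcl : IsClosed (T v)) (hcv : Convex ℝ (T v)) :
    (zCandidates C f T g β e v x).Nonempty := by
  obtain ⟨φ, hφ, hφpos⟩ := hC.exists_pos_functional
  have hφe := hφpos e he
  -- This is φ composed with the vector objective; since φ > 0 on int C, its minimizers are weakly
  -- efficient.
  set h : E → ℝ := fun y => β * φ (f x y) + φ e * (g y - gateauxDeriv g x y) with hdef
  have hfc : ConvexOn ℝ univ fun y => φ (f x y) := by
    refine ⟨convex_univ, fun a _ b _ s t hs ht hst => ?_⟩
    obtain rfl : t = 1 - s := by linarith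
    have h1 := hφ _ (hB3 x a b s hs (by linarith))
    simp only [map_sub, map_add, map_smul, smul_eq_mul] at h1 ⊢
    linarith
  have hgc : ConvexOn ℝ univ fun y => g y - gateauxDeriv g x y :=
    hg.strictConvex.convexOn.sub ((gateauxDeriv g x : E →ₗ[ℝ] ℝ).concaveOn convex_univ)
  have hhc : ConvexOn ℝ univ h := (hfc.smul hβ).add (hgc.smul hφe.le)
  have hfct : Continuous fun y => φ (f x y) := φ.continuous.comp (hB2.continuous_right x)
  have hgct := hg.continuous h3
  have hhct : Continuous h := by
    exact (hfct.const_mul β).add ((hgct.sub (gateauxDeriv g x).continuous).const_mul (φ e))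
  -- an affine minorant of the scalarized bifunction
  obtain ⟨a, b, hab⟩ : ∃ a b : ℝ, ∀ y, a * ‖y‖ + b ≤ φ (f x y) := by
    obtain ⟨L, c, hL, -⟩ := ConvexOn.exists_affine_le_of_lt (𝕜 := ℝ) (mem_univ (0 : E))
      (sub_one_lt (φ (f x 0))) isClosed_univ (hfct.lowerSemicontinuous.lowerSemicontinuousOn _)
      hfc
    exact ⟨-‖L‖, c, fun y => by
      have := neg_le_of_abs_le (L.le_opNorm y)
      have hLy : L y + c ≤ φ (f x y) := by simpa using hL ⟨y, mem_univ y⟩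
      linarith⟩
  -- The bifunction decreases at most linearly, so a sublevel set bounds g by an affine function of
  -- the norm, and H4 applies.
  have hbd : ∀ r, IsBounded {y | h y ≤ r} := fun r => by
    refine (h4.isBounded_setOf_le (‖gateauxDeriv g x‖ - β * a / φ e)
      ((r - β * b) / φ e)).subset fun y hy => ?_
    simp only [mem_ofPred_eq, hdef] at hy ⊢
    have h1 := (le_abs_self _).trans ((gateauxDeriv g x).le_opNorm y)
    have h2 := mul_le_mul_of_nonneg_left (hab y) hβ
    have h5 : g y - gateauxDeriv g x y ≤ (r - β * (a * ‖y‖ + b)) / φ e := by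
      rw [le_div_iff₀ hφe]
      linarith
    have h6 : (r - β * (a * ‖y‖ + b)) / φ e = -(β * a / φ e) * ‖y‖ + (r - β * b) / φ e := by
      field_simp
      ring
    linarith
  obtain ⟨z, hzT, hz⟩ := hE.exists_isMinOn hhc hhct hbd hne hcl hcv
  refine ⟨z, hzT, fun s hs hmem => ?_⟩
  have h1 := hφpos _ hmem
  have h2 := hz s hs
  simp only [map_sub, map_add, map_smul, smul_eq_mul, hdef] at h1 h2
  linarith

/-- The linesearch is finite. -/
theorem acceptedExponents_nonempty [Nontrivial Y] (hC : IsOrderingCone C) (hB1 : B1 f) (hB2 : B2 f)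
    (hg : IsBregmanFunction g) {T : E → Set E} {β δ θ : ℝ} {e : Y} (he : e ∈ interior (C : Set Y))
    (hδ : δ < 1) (hθ : θ ∈ Ioo (0 : ℝ) 1) {v x z : E}
    (hz : z ∈ zCandidates C f T g β e v x) (hx : x ∈ T v) :
    (acceptedExponents C f g δ θ β e x z).Nonempty := by
  -- The stopping test compares z with v, not with x, so z = x can occur; the tested vector is then
  -- 0.
  by_cases hzx : z = x
  · refine ⟨0, ?_⟩
    simpa [acceptedExponents, trialPoint, hzx, hB1 x] using hC.zero_notMem_interior
  by_contra! hemp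
  have hin : ∀ l, -(β • f (trialPoint θ x z l) x) + β • f (trialPoint θ x z l) z
      + (δ * bregmanDist g z x) • e ∈ C := by
    intro l
    by_contra hl
    exact (eq_empty_iff_forall_notMem.1 hemp l) fun h => hl (interior_subset h)
  have ht : Tendsto (trialPoint θ x z) atTop (𝓝 x) := by
    have h1 := tendsto_pow_atTop_nhds_zero_of_lt_one hθ.1.le hθ.2
    have h2 := (h1.smul_const z).add ((h1.const_sub 1).smul_const x)
    rw [zero_smul, sub_zero, one_smul, zero_add] at h2
    exact h2
  have hcont : Continuous fun y => -(β • f y x) + β • f y z + (δ * bregmanDist g z x) • e := by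
    have h1 : Continuous fun y => f y x := hB2.continuous.comp (Continuous.prodMk_left x)
    have h2 : Continuous fun y => f y z := hB2.continuous.comp (Continuous.prodMk_left z)
    fun_prop
  -- If every exponent were rejected, β f(x, z) + δ D(z, x) e would be in C; adding (1 - δ) D(z, x)
  -- e contradicts the efficiency of z against x.
  have hlim : -(β • f x x) + β • f x z + (δ * bregmanDist g z x) • e ∈ C :=
    C.isClosed.mem_of_tendsto ((hcont.tendsto x).comp ht) (Eventually.of_forall hin)
  rw [hB1, smul_zero, neg_zero, zero_add] at hlim
  refine notMem_interior_of_mem_zCandidates_self hB1 hz hx ?_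
  have h1 := add_mem_interior (smul_mem_interior
    (mul_pos (sub_pos.2 hδ) (hg.bregmanDist_pos hzx)) he) hlim
  convert h1 using 1
  module

/-- A fixed point at which the regularized problem is solved solves the problem itself. -/
theorem IsBregmanFunction.notMem_interior_of_regularized (hg : IsBregmanFunction g) (hB1 : B1 f)
    (hB3 : B3 C f) {β : ℝ} (hβ : 0 < β) {e : Y} {A : Set E} (hA : Convex ℝ A) {x : E} (hx : x ∈ A)
    (h : ∀ y ∈ A, -(β • f x y) - bregmanDist g y x • e ∉ interior (C : Set Y)) :
    ∀ y ∈ A, -f x y ∉ interior (C : Set Y) := by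
  intro y hy hmem
  -- On the segment towards y, C-convexity bounds f by t f(x, y) while the regularization is o(t),
  -- so a violation at y survives for small t.
  have hlim : Tendsto (fun t : ℝ => β • (-f x y) - (bregmanDist g (x + t • (y - x)) x / t) • e)
      (𝓝[>] 0) (𝓝 (β • (-f x y))) := by
    simpa using ((hg.tendsto_bregmanDist_div x (y - x)).smul_const e).const_sub (β • (-f x y))
  obtain ⟨t, ⟨ht, ht0⟩, ht1⟩ := ((hlim.eventually (isOpen_interior.mem_nhds
    (smul_mem_interior hβ hmem))).and self_mem_nhdsWithin |>.and
    (Ioo_mem_nhdsGT (zero_lt_one' ℝ))).exists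
  have ht0 : 0 < t := ht0
  refine h (x + t • (y - x)) (hA.add_smul_sub_mem hx hy ⟨ht0.le, ht1.2.le⟩) ?_
  have h1 := hB3 x y x t ht0.le ht1.2.le
  rw [hB1, smul_zero, add_zero] at h1
  have h2 := add_mem_interior (smul_mem_interior ht0 ht) (smul_mem_cone hβ.le h1)
  have h3 : x + t • (y - x) = t • y + (1 - t) • x := by module
  rw [h3] at h2 ⊢
  rw [smul_sub t, smul_smul t (_ / t), mul_div_cancel₀ _ ht0.ne'] at h2
  convert h2 using 1
  module

end VectorBifunction

/-! ### The half-spaces L_k, M_k and N_k. -/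

section HalfSpaces

variable {E : Type*} [NormedAddCommGroup E] [NormedSpace ℝ E] {g : E → ℝ} {K : Set E}

theorem isClosed_bregmanCut (γ : ℝ) (a b : E) : IsClosed (bregmanCut g γ a b) :=
  isClosed_le (by fun_prop) continuous_const

theorem isClosed_originCut (v0 v : E) : IsClosed (originCut g v0 v) :=
  isClosed_le (by fun_prop) continuous_const

theorem convex_halfSpace_sub (φ : StrongDual ℝ E) (a : E) (r : ℝ) :
    Convex ℝ {z | φ (z - a) ≤ r} := by
  simp only [map_sub, sub_le_iff_le_add]
  exact convex_halfSpace_le φ.isLinear _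

theorem isClosed_nextSet (hK : IsClosed K) (γ : ℝ) (v0 v x w : E) :
    IsClosed (nextSet K g γ v0 v x w) :=
  hK.inter (((isClosed_bregmanCut _ _ _).inter (isClosed_bregmanCut _ _ _)).inter
    (isClosed_originCut _ _))

theorem convex_nextSet (hK : Convex ℝ K) (γ : ℝ) (v0 v x w : E) :
    Convex ℝ (nextSet K g γ v0 v x w) :=
  hK.inter (((convex_halfSpace_sub _ _ _).inter (convex_halfSpace_sub _ _ _)).inter
    (convex_halfSpace_sub _ _ _))

/-- If `z` is at most as `D_g`-far from `b` as from `a`, it lies in the cut at `(a, b)`. -/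
theorem IsBregmanFunction.mem_bregmanCut (hg : IsBregmanFunction g) {γ : ℝ} (hγ : γ ≤ 1)
    {a b z : E} (h : bregmanDist g z b ≤ bregmanDist g z a) : z ∈ bregmanCut g γ a b := by
  -- The functional defining the cut equals D(z, b) - D(z, a) - D(a, b) at z.
  have h1 := bregmanDist_three_point g z a b
  have h2 := mul_le_mul_of_nonneg_right hγ (hg.bregmanDist_nonneg a b)
  change (gateauxDeriv g a - gateauxDeriv g b) (z - a) ≤ -γ * bregmanDist g a b
  linarith

/-- The Bregman distance of the two base points of a cut tends to `0` if points of the cut approach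
the first base point. -/
theorem IsBregmanFunction.tendsto_bregmanDist_of_mem_bregmanCut (hg : IsBregmanFunction g)
    (h3 : H3 g) {ι : Type*} {l : Filter ι} {u a b : ι → E} {γ : ι → ℝ} {ε : ℝ} (hε : 0 < ε)
    (hγ : ∀ i, ε ≤ γ i) (ha : IsBounded (range a)) (hb : IsBounded (range b))
    (hu : ∀ i, u i ∈ bregmanCut g (γ i) (a i) (b i))
    (h : Tendsto (fun i => u i - a i) l (𝓝 0)) :
    Tendsto (fun i => bregmanDist g (a i) (b i)) l (𝓝 0) := by
  obtain ⟨M, hM0, hM⟩ := exists_norm_gateauxDeriv_le h3 (ha.union hb)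
  -- The cut inequality gives ε D(a, b) ≤ ‖g'(a) - g'(b)‖ ‖u - a‖, and M + M bounds the first
  -- factor.
  have hlim : Tendsto (fun i => (M + M) * ‖u i - a i‖ / ε) l (𝓝 0) := by
    simpa using (h.norm.const_mul (M + M)).div_const ε
  refine squeeze_zero (fun i => hg.bregmanDist_nonneg _ _) (fun i => ?_) hlim
  rw [le_div_iff₀ hε]
  have h1 : (gateauxDeriv g (a i) - gateauxDeriv g (b i)) (u i - a i)
      ≤ -γ i * bregmanDist g (a i) (b i) := hu i
  have h2 := mul_le_mul_of_nonneg_right (hγ i) (hg.bregmanDist_nonneg (a i) (b i))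
  have h4 := (gateauxDeriv g (a i) - gateauxDeriv g (b i)).le_of_opNorm_le
    ((norm_sub_le _ _).trans (add_le_add (hM _ (Or.inl (mem_range_self i)))
      (hM _ (Or.inr (mem_range_self i))))) (u i - a i)
  have h5 := neg_le_of_abs_le h4
  linarith

end HalfSpaces

/-! ### The fixed point set of T. -/

section FixedPoints

variable {E : Type*} [NormedAddCommGroup E] [NormedSpace ℝ E] {g : E → ℝ} {K : Set E}
  {T : E → Set E}

/-- Uniqueness of projections makes points of Fix(T) fixed points of the selection S, and identifies
x with S(v). -/
theorem B4.bregmanDist_le (hT : B4 g K T) (hg : IsBregmanFunction g) {p v x : E}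
    (hp : p ∈ Fix K T) (hv : v ∈ K) (hx : IsBregmanProj g (T v) v x) :
    bregmanDist g p x ≤ bregmanDist g p v := by
  obtain ⟨S, hS, -, -, hq⟩ := hT.quasi
  have h1 : S p = p := hg.isBregmanProj_unique (hT.convex p hp.1) (hS p hp.1)
    (hg.isBregmanProj_self_of_mem hp.2)
  have h2 : x = S v := hg.isBregmanProj_unique (hT.convex v hv) hx (hS v hv)
  rw [h2]
  exact hq p hp.1 h1 v hv

/-- The difference D(·, S r) - D(·, r) is affine and nonpositive at p and q, hence at their convex
combination r; so D(r, S r) ≤ 0 and r = S r. Convexity makes the projection onto K_∞ ∩ Fix(T)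
unique. -/
theorem B4.convex_fix (hT : B4 g K T) (hg : IsBregmanFunction g) (hK : Convex ℝ K) :
    Convex ℝ (Fix K T) := by
  intro p hp q hq s t hs ht hst
  have hr := hK hp.1 hq.1 hs ht hst
  obtain ⟨S, hS, -⟩ := hT.quasi
  set r := s • p + t • q with hrdef
  have h1 := hT.bregmanDist_le hg hp hr (hS r hr)
  have h2 := hT.bregmanDist_le hg hq hr (hS r hr)
  have h3 : bregmanDist g r (S r) ≤ 0 := by
    have e1 := mul_le_mul_of_nonneg_left h1 hs
    have e2 := mul_le_mul_of_nonneg_left h2 ht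
    have e3 : gateauxDeriv g (S r) r = s * gateauxDeriv g (S r) p + t * gateauxDeriv g (S r) q := by
      rw [hrdef, map_add, map_smul, map_smul, smul_eq_mul, smul_eq_mul]
    have e4 : gateauxDeriv g r r = s * gateauxDeriv g r p + t * gateauxDeriv g r q := by
      conv_lhs => rw [hrdef, map_add, map_smul, map_smul, smul_eq_mul, smul_eq_mul]
    obtain rfl : t = 1 - s := by linarith
    simp only [bregmanDist, map_sub] at e1 e2 ⊢
    linarith
  have h4 : r = S r := by
    by_contra hne
    exact absurd (hg.bregmanDist_pos hne) (not_lt.2 h3)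
  have h5 := (hS r hr).1
  rw [← h4] at h5
  exact ⟨hr, h5⟩

end FixedPoints

/-! ### Well-definedness, boundedness and finite termination. -/

section Algorithm

variable {E Y : Type*} [NormedAddCommGroup E] [NormedSpace ℝ E]
  [NormedAddCommGroup Y] [NormedSpace ℝ Y] {K : Set E} {C : ProperCone ℝ Y} {f : E → E → Y}
  {T : E → Set E} {g : E → ℝ} {P : Params K C} {s : Iterates E} {n : ℕ}

theorem trialPoint_mem {A : Set E} (hA : Convex ℝ A) {θ : ℝ} (hθ : θ ∈ Ioo (0 : ℝ) 1) {x z : E}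
    (hx : x ∈ A) (hz : z ∈ A) (l : ℕ) : trialPoint θ x z l ∈ A :=
  hA hz hx (pow_nonneg hθ.1.le l) (sub_nonneg.2 (pow_le_one₀ hθ.1.le hθ.2.le)) (by ring)

theorem Run.partialRun (h : Run K C f T g P s) (n : ℕ) : PartialRun K C f T g P s n :=
  ⟨h.1, fun k _ => h.2 k⟩

theorem PartialRun.mono (h : PartialRun K C f T g P s n) {m : ℕ} (hm : m ≤ n) :
    PartialRun K C f T g P s m :=
  ⟨h.1, fun k hk => h.2 k (hk.trans_le hm)⟩

theorem PartialRun.v_mem (h : PartialRun K C f T g P s n) : s.v n ∈ K := by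
  cases n with
  | zero => exact h.1 ▸ P.v0_mem
  | succ n => exact (h.2 n n.lt_succ_self).v_next.1.1

theorem Step.y_mem {k : ℕ} (h : Step K C f T g P s k) (hT : B4 g K T) (hv : s.v k ∈ K) :
    s.y k ∈ T (s.v k) := by
  rw [h.y_eq]
  exact trialPoint_mem (hT.convex _ hv) P.θ_mem h.x_proj.1 h.z_mem.1 _

theorem mem_nextSet (hg : IsBregmanFunction g) (hT : B4 g K T) {A : Set E} (hA : Convex ℝ A)
    {γ : ℝ} (hγ : γ ≤ 1) {v0 v x w p : E} (hp : p ∈ Fix K T) (hpA : p ∈ A) (hv : v ∈ K)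
    (hx : IsBregmanProj g (T v) v x) (hw : IsBregmanProj g A x w) (hpo : p ∈ originCut g v0 v) :
    p ∈ nextSet K g γ v0 v x w := by
  refine ⟨hp.1, ⟨hg.mem_bregmanCut hγ ?_, hg.mem_bregmanCut hγ (hT.bregmanDist_le hg hp hv hx)⟩, hpo⟩
  linarith [hg.pythagoras hA hw hpA, hg.bregmanDist_nonneg w x]

/-- By induction p lies in the set whose projection of v^0 is the next iterate, and the variational
inequality of that projection is the next origin cut. At the start the functional is 0. -/
theorem PartialRun.mem_originCut (hg : IsBregmanFunction g) (hT : B4 g K T) (hK : Convex ℝ K)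
    (hB3 : B3 C f) (h : PartialRun K C f T g P s n) {p : E} (hp : p ∈ Fix K T)
    (hpc : p ∈ cutSet K C f s.y n) : p ∈ originCut g P.v0 (s.v n) := by
  induction n with
  | zero =>
    change (gateauxDeriv g P.v0 - gateauxDeriv g (s.v 0)) (p - s.v 0) ≤ 0
    rw [h.1, sub_self]
    exact le_rfl
  | succ n ih =>
    have hn := h.mono n.le_succ
    have hstep := h.2 n n.lt_succ_self
    exact hg.variational_of_isBregmanProj (convex_nextSet hK _ _ _ _ _) hstep.v_next
      (mem_nextSet hg hT (convex_cutSet hB3 hK _ _) (P.γ_mem n).2 hp hpc hn.v_mem hstep.x_proj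
        hstep.w_proj (ih hn hpc.1))

theorem Run.mem_nextSet (hg : IsBregmanFunction g) (hT : B4 g K T) (hK : Convex ℝ K)
    (hB3 : B3 C f) (h : Run K C f T g P s) {p : E} (hp : p ∈ Fix K T)
    (hpc : ∀ k, p ∈ cutSet K C f s.y k) (k : ℕ) :
    p ∈ nextSet K g (P.γ k) P.v0 (s.v k) (s.x k) (s.w k) :=
  VQEP.mem_nextSet hg hT (convex_cutSet hB3 hK _ _) (P.γ_mem k).2 hp (hpc (k + 1))
    (h.partialRun k).v_mem (h.2 k).x_proj (h.2 k).w_proj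
    ((h.partialRun k).mem_originCut hg hT hK hB3 hp (hpc k))

theorem Run.bregmanDist_v_le (hg : IsBregmanFunction g) (hT : B4 g K T) (hK : Convex ℝ K)
    (hB3 : B3 C f) (h : Run K C f T g P s) {p : E} (hp : p ∈ Fix K T)
    (hpc : ∀ k, p ∈ cutSet K C f s.y k) (k : ℕ) :
    bregmanDist g (s.v k) P.v0 ≤ bregmanDist g p P.v0 := by
  cases k with
  | zero =>
    rw [h.1, bregmanDist_self]
    exact hg.bregmanDist_nonneg _ _
  | succ k => exact (h.2 k).v_next.2 p (h.mem_nextSet hg hT hK hB3 hp hpc k)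

theorem PartialRun.mem_cutSet_of_mem_DS (hT : B4 g K T) (h : PartialRun K C f T g P s n) {p : E}
    (hp : p ∈ DS K C f T) : p ∈ cutSet K C f s.y n := by
  induction n with
  | zero => exact hp.1.1
  | succ n ih =>
    have hn := h.mono n.le_succ
    exact ⟨ih hn, hp.2 _ (hT.subset _ hn.v_mem ((h.2 n n.lt_succ_self).y_mem hT hn.v_mem))⟩

/-- The one point p lies in every set to be projected onto from K_k and L_k ∩ M_k ∩ N_k, whatever
z^k was chosen. -/
theorem wellDefined_of_mem_DS [Nontrivial Y] (hE : IsReflexive E) (hKcl : IsClosed K)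
    (hKcv : Convex ℝ K) (hC : IsOrderingCone C) (hB1 : B1 f) (hB2 : B2 f) (hB3 : B3 C f)
    (hg : IsBregmanFunction g) (h3 : H3 g) (h4 : H4 g) (hT : B4 g K T) {p : E}
    (hp : p ∈ DS K C f T) : WellDefined K C f T g P := by
  intro n s h
  have hv := h.v_mem
  have hpc := h.mem_cutSet_of_mem_DS hT hp
  refine ⟨hv, hg.existsUnique_isBregmanProj hE h3 h4 (hT.nonempty _ hv) (hT.closed _ hv)
    (hT.convex _ hv) _, fun x hx => ⟨?_, fun z hz _ => ?_⟩⟩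
  · exact zCandidates_nonempty hC hE hB2 hB3 hg h3 h4 (P.βlo_pos.le.trans (P.β_mem n).1)
      (P.e_mem n) (hT.nonempty _ hv) (hT.closed _ hv) (hT.convex _ hv)
  · have hne := acceptedExponents_nonempty hC hB1 hB2 hg (P.e_mem n) P.δ_mem.2 P.θ_mem hz hx.1
    refine ⟨sInf _, ⟨Nat.sInf_mem hne, fun m hm => Nat.sInf_le hm⟩, ?_⟩
    set l := sInf (acceptedExponents C f g P.δ P.θ (P.β n) (P.e n) x z)
    have hcv := (convex_cutSet hB3 hKcv s.y n).inter (convex_cutH hB3 (trialPoint P.θ x z l))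
    have hpA : p ∈ cutSet K C f s.y n ∩ cutH C f (trialPoint P.θ x z l) :=
      ⟨hpc, hp.2 _ (hT.subset _ hv (trialPoint_mem (hT.convex _ hv) P.θ_mem hx.1 hz.1 l))⟩
    refine ⟨hg.existsUnique_isBregmanProj hE h3 h4 ⟨p, hpA⟩
      ((isClosed_cutSet hB2 hKcl s.y n).inter (isClosed_cutH hB2 _)) hcv x, fun w hw => ?_⟩
    exact hg.existsUnique_isBregmanProj hE h3 h4
      ⟨p, mem_nextSet hg hT hcv (P.γ_mem n).2 hp.1 hpA hv hx hw
        (h.mem_originCut hg hT hKcv hB3 hp.1 hpc)⟩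
      (isClosed_nextSet hKcl _ _ _ _ _) (convex_nextSet hKcv _ _ _ _ _) _

theorem Run.boundedIterates_of_mem_DS (hKcv : Convex ℝ K) (hB3 : B3 C f)
    (hg : IsBregmanFunction g) (h1 : H1 g) (h3 : H3 g) (h4 : H4 g) (hT : B4 g K T) {p : E}
    (hp : p ∈ DS K C f T) (h : Run K C f T g P s) : BoundedIterates s := by
  have hpc : ∀ k, p ∈ cutSet K C f s.y k := fun k => (h.partialRun k).mem_cutSet_of_mem_DS hT hp
  have hv : IsBounded (range s.v) := by
    refine (isBounded_setOf_bregmanDist_le h4 P.v0 (bregmanDist g p P.v0)).subset ?_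
    rintro _ ⟨k, rfl⟩
    exact h.bregmanDist_v_le hg hT hKcv hB3 hp.1 hpc k
  obtain ⟨M, hM⟩ := hg.exists_bregmanDist_le h3 (hv.union (isBounded_singleton (x := p)))
  have hx : ∀ k, bregmanDist g p (s.x k) ≤ M := fun k =>
    (hT.bregmanDist_le hg hp.1 (h.partialRun k).v_mem (h.2 k).x_proj).trans
      (hM _ (Or.inr rfl) _ (Or.inl (mem_range_self k)))
  -- Here p is the first argument of D, so H1 is needed; for v^k the fixed point v^0 was the second
  -- argument and H4 sufficed.
  refine ⟨(h1 p M).subset ?_, hv, (h1 p M).subset ?_⟩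
  · rintro _ ⟨k, rfl⟩
    exact hx k
  · rintro _ ⟨k, rfl⟩
    have := hg.pythagoras (convex_cutSet hB3 hKcv _ _) (h.2 k).w_proj (hpc (k + 1))
    exact le_trans (by linarith [hg.bregmanDist_nonneg (s.w k) (s.x k)]) (hx k)

/-- A run that stops does so at a solution. -/
theorem StopsAt.mem_S (hg : IsBregmanFunction g) (hT : B4 g K T) (hB1 : B1 f) (hB3 : B3 C f)
    (h : StopsAt K C f T g P s n) : s.x n = s.v n ∧ s.x n ∈ S K C f T := by
  have hv := h.partialRun.v_mem
  have hvT : s.v n ∈ T (s.v n) := h.z_eq_v ▸ h.z_mem.1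
  have hxv : s.x n = s.v n := hg.isBregmanProj_unique (hT.convex _ hv) h.x_proj
    (hg.isBregmanProj_self_of_mem hvT)
  refine ⟨hxv, hxv ▸ ⟨⟨hv, hvT⟩, ?_⟩⟩
  -- With z = v = x, weak efficiency of z is exactly the regularized problem at x.
  refine hg.notMem_interior_of_regularized hB1 hB3 (P.βlo_pos.trans_le (P.β_mem n).1)
    (hT.convex _ hv) hvT (e := P.e n) fun y hy => ?_
  have h1 := notMem_interior_of_mem_zCandidates h.z_mem hy
  rw [h.z_eq_v, hxv, hB1] at h1
  convert h1 using 2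
  simp only [bregmanDist, map_sub]
  module

end Algorithm

/-! ### Strong convergence and optimality of the limit. -/

section Convergence

variable {E Y : Type*} [NormedAddCommGroup E] [NormedSpace ℝ E]
  [NormedAddCommGroup Y] [NormedSpace ℝ Y] {K : Set E} {C : ProperCone ℝ Y} {f : E → E → Y}
  {T : E → Set E} {g : E → ℝ} {P : Params K C} {s : Iterates E}

theorem Params.β_pos (P : Params K C) (k : ℕ) : 0 < P.β k :=
  P.βlo_pos.trans_le (P.β_mem k).1

theorem Params.tendsto_β_smul (P : Params K C) {l : Filter ℕ} {r : ℕ → Y}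
    (hr : Tendsto r l (𝓝 0)) : Tendsto (fun k => P.β k • r k) l (𝓝 0) := by
  have h : Tendsto (fun k => P.βhi * ‖r k‖) l (𝓝 0) := by simpa using hr.norm.const_mul P.βhi
  refine squeeze_zero_norm (fun k => ?_) h
  rw [norm_smul, Real.norm_of_nonneg (P.β_pos k).le]
  exact mul_le_mul_of_nonneg_right (P.β_mem k).2 (norm_nonneg _)

/-- A single multiple N e^k dominates all vectors of norm at most M: after division by N they are
shorter than r/2, and e^k is eventually within r/2 of the centre of a ball of radius r in int C. -/
theorem Params.eventually_add_smul_mem_interior (P : Params K C) (M : ℝ) :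
    ∃ N : ℝ, 0 < N ∧ ∀ᶠ k in atTop, ∀ b : Y, ‖b‖ ≤ M → b + N • P.e k ∈ interior (C : Set Y) := by
  obtain ⟨r, hr, hball⟩ := Metric.isOpen_iff.1 isOpen_interior _ P.ebar_mem
  have hN : 0 < 2 * |M| / r + 1 := by positivity
  refine ⟨_, hN, ?_⟩
  set N := 2 * |M| / r + 1 with hNdef
  filter_upwards [P.e_tendsto (Metric.ball_mem_nhds _ (half_pos hr))] with k hk b hb
  rw [mem_preimage, mem_ball_iff_norm] at hk
  have h1 : N⁻¹ • b + P.e k ∈ interior (C : Set Y) := by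
    refine hball (mem_ball_iff_norm.2 ?_)
    have h2 : ‖N⁻¹ • b‖ < r / 2 := by
      rw [norm_smul, norm_inv, Real.norm_of_nonneg hN.le, inv_mul_lt_iff₀ hN]
      have h3 : N * (r / 2) = |M| + r / 2 := by
        rw [hNdef]
        field_simp
      linarith [le_abs_self M]
    calc ‖N⁻¹ • b + P.e k - P.ebar‖ = ‖N⁻¹ • b + (P.e k - P.ebar)‖ := by rw [add_sub_assoc]
      _ ≤ _ := norm_add_le _ _
      _ < r := by linarith
  have h4 := smul_mem_interior hN h1
  rwa [smul_add, smul_inv_smul₀ hN.ne'] at h4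

/-- The points `z^k` stay bounded if the `x^k` do. -/
theorem isBounded_range_z (hB1 : B1 f) (hB2 : B2 f) (hB3 : B3 C f) (hg : IsBregmanFunction g)
    (h3 : H3 g) (h4 : H4 g) {v x z : ℕ → E} (hx : IsBounded (range x))
    (hxT : ∀ k, x k ∈ T (v k)) (hz : ∀ k, z k ∈ zCandidates C f T g (P.β k) (P.e k) (v k) (x k)) :
    IsBounded (range z) := by
  obtain ⟨R, hR⟩ : ∃ R, ∀ k, ‖x k‖ ≤ R := by
    obtain ⟨R, hR⟩ := hx.exists_norm_le
    exact ⟨R, fun k => hR _ (mem_range_self k)⟩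
  have hR0 : 0 ≤ R := (norm_nonneg _).trans (hR 0)
  obtain ⟨M, hM⟩ : ∃ M, ∀ k u, ‖u - x k‖ ≤ 1 → ‖f (x k) u‖ ≤ M := by
    obtain ⟨M, hM⟩ := (isBounded_image_of_uniformContinuousOn hB2
      (Metric.isBounded_closedBall (x := (0 : E × E)) (r := R + 1))).exists_norm_le
    refine ⟨M, fun k u hu => hM _ ⟨(x k, u), ?_, rfl⟩⟩
    rw [mem_closedBall_zero_iff]
    refine max_le (by linarith [hR k]) ?_
    have := norm_add_le (u - x k) (x k)
    rw [sub_add_cancel] at this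
    linarith [hR k]
  obtain ⟨N, hN, hint⟩ := P.eventually_add_smul_mem_interior (P.βhi * M)
  -- At the point u of the segment at distance 1 from x^k, f is bounded. C-convexity bounds f(x^k,
  -- z^k) below by ‖z^k - x^k‖ f(x^k, u), so a larger D would contradict efficiency against x^k.
  -- This linear bound and H4 then bound z^k.
  have hD : ∀ᶠ k in atTop, 1 ≤ ‖z k - x k‖ → bregmanDist g (z k) (x k) ≤ N * ‖z k - x k‖ := by
    filter_upwards [hint] with k hk hzx
    by_contra! hlt
    set r := ‖z k - x k‖
    have hr0 : 0 < r := by linarith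
    have hr1 : r⁻¹ ≤ 1 := inv_le_one_of_one_le₀ hzx
    set u := r⁻¹ • z k + (1 - r⁻¹) • x k with hu
    have hux : u - x k = r⁻¹ • (z k - x k) := by rw [hu]; module
    have hfu : ‖P.β k • f (x k) u‖ ≤ P.βhi * M := by
      rw [norm_smul, Real.norm_of_nonneg (P.β_pos k).le]
      refine mul_le_mul (P.β_mem k).2 (hM k u ?_) (norm_nonneg _)
        (P.βlo_pos.le.trans P.βlo_le)
      rw [hux, norm_smul, norm_inv, Real.norm_of_nonneg hr0.le, inv_mul_cancel₀ hr0.ne']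
    have h1 := hB3 (x k) (z k) (x k) r⁻¹ (by positivity) hr1
    rw [hB1, smul_zero, add_zero, ← hu] at h1
    have h2 := add_mem_interior (add_mem_interior (smul_mem_interior hr0 (hk _ hfu))
      (smul_mem_cone (mul_nonneg hr0.le (P.β_pos k).le) h1))
      (smul_mem_cone (sub_nonneg.2 hlt.le) (interior_subset (P.e_mem k)))
    refine notMem_interior_of_mem_zCandidates_self hB1 (hz k) (hxT k) ?_
    convert h2 using 1
    rw [smul_sub (r * P.β k), smul_smul (r * P.β k) r⁻¹,
      show r * P.β k * r⁻¹ = P.β k by field_simp]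
    module
  obtain ⟨G, hG0, hG⟩ := exists_norm_gateauxDeriv_le h3 hx
  obtain ⟨B, hB⟩ : ∃ B, ∀ k, g (x k) ≤ B := by
    obtain ⟨D, hD⟩ := hg.exists_bregmanDist_le h3 (hx.union (isBounded_singleton (x := (0 : E))))
    refine ⟨D + g 0 + ‖gateauxDeriv g 0‖ * R, fun k => ?_⟩
    have h5 := hD (x k) (Or.inl (mem_range_self k)) 0 (Or.inr rfl)
    have h6 := (le_abs_self _).trans ((gateauxDeriv g 0).le_opNorm (x k))
    have h7 := mul_le_mul_of_nonneg_left (hR k) (norm_nonneg (gateauxDeriv g 0))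
    simp only [bregmanDist, sub_zero] at h5
    linarith
  obtain ⟨k0, hk0⟩ := eventually_atTop.1 hD
  have hfin : IsBounded (z '' {k | k < k0}) := ((finite_lt_nat k0).image z).isBounded
  refine ((hfin.union (h4.isBounded_setOf_le (N + G) (B + (N + G) * R))).union
    (Metric.isBounded_closedBall (x := (0 : E)) (r := R + 1))).subset ?_
  rintro _ ⟨k, rfl⟩
  rcases lt_or_ge k k0 with hk | hk
  · exact Or.inl (Or.inl ⟨k, hk, rfl⟩)
  rcases le_or_gt 1 ‖z k - x k‖ with h1 | h1
  · refine Or.inl (Or.inr ?_)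
    have h5 := hk0 k hk h1
    have h6 : gateauxDeriv g (x k) (z k - x k) ≤ G * ‖z k - x k‖ :=
      (le_abs_self _).trans ((gateauxDeriv g (x k)).le_of_opNorm_le (hG _ (mem_range_self k)) _)
    have h7 : (N + G) * ‖z k - x k‖ ≤ (N + G) * (‖z k‖ + R) :=
      mul_le_mul_of_nonneg_left ((norm_sub_le _ _).trans (by linarith [hR k])) (by linarith)
    simp only [bregmanDist] at h5
    change g (z k) ≤ (N + G) * ‖z k‖ + (B + (N + G) * R)
    linarith [hB k]
  · refine Or.inr (mem_closedBall_zero_iff.2 ?_)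
    have := norm_add_le (z k - x k) (x k)
    rw [sub_add_cancel] at this
    linarith [hR k]

/-- Consecutive iterates approach each other. -/
theorem Run.tendsto_sub (hg : IsBregmanFunction g) (h2 : H2 g) (h3 : H3 g)
    (h : Run K C f T g P s) (hb : BoundedIterates s) :
    Tendsto (fun k => s.v k - s.x k) atTop (𝓝 0) ∧
      Tendsto (fun k => s.x k - s.w k) atTop (𝓝 0) := by
  obtain ⟨hbx, hbv, hbw⟩ := hb
  -- The cut N_k turns the three-point identity into a telescoping bound.
  have hstep : ∀ k, bregmanDist g (s.v (k + 1)) (s.v k)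
      ≤ bregmanDist g (s.v (k + 1)) P.v0 - bregmanDist g (s.v k) P.v0 := fun k => by
    have h5 : (gateauxDeriv g P.v0 - gateauxDeriv g (s.v k)) (s.v (k + 1) - s.v k) ≤ 0 :=
      (h.2 k).v_next.1.2.2
    have h6 := bregmanDist_three_point g (s.v (k + 1)) (s.v k) P.v0
    simp only [sub_apply] at h5 h6
    linarith
  have hmono : Monotone fun k => bregmanDist g (s.v k) P.v0 := monotone_nat_of_le_succ fun k => by
    linarith [hstep k, hg.bregmanDist_nonneg (s.v (k + 1)) (s.v k)]
  obtain ⟨M, hM⟩ := hg.exists_bregmanDist_le h3 hbv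
  have hbdd : BddAbove (range fun k => bregmanDist g (s.v k) P.v0) := by
    refine ⟨M, ?_⟩
    rintro _ ⟨k, rfl⟩
    exact hM _ (mem_range_self k) _ ⟨0, h.1⟩
  have hconv := tendsto_atTop_ciSup hmono hbdd
  have hv : Tendsto (fun k => s.v (k + 1) - s.v k) atTop (𝓝 0) := by
    refine hg.tendsto_sub_of_tendsto_bregmanDist h2 hbv
      (squeeze_zero (fun k => hg.bregmanDist_nonneg _ _) hstep ?_)
    simpa using (hconv.comp (tendsto_add_atTop_nat 1)).sub hconv
  have hvx : Tendsto (fun k => s.v k - s.x k) atTop (𝓝 0) :=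
    hg.tendsto_sub_of_tendsto_bregmanDist h2 hbx
      (hg.tendsto_bregmanDist_of_mem_bregmanCut h3 P.ε_mem.1 (fun k => (P.γ_mem k).1) hbv hbx
        (fun k => (h.2 k).v_next.1.2.1.2) hv)
  refine ⟨hvx, hg.tendsto_sub_of_tendsto_bregmanDist h2 hbw
    (hg.tendsto_bregmanDist_of_mem_bregmanCut h3 P.ε_mem.1 (fun k => (P.γ_mem k).1) hbx hbw
      (fun k => (h.2 k).v_next.1.2.1.1) ?_)⟩
  simpa using hv.add hvx

/-- A weak limit point of `v^k` is a strong one, and it is the projection of `v^0` onto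
`K_∞ ∩ Fix(T)`. -/
theorem Run.tendsto_of_weaklyTendsto (hKcl : IsClosed K) (hKcv : Convex ℝ K) (hB2 : B2 f)
    (hB3 : B3 C f) (hg : IsBregmanFunction g) (h2 : H2 g) (h3 : H3 g) (hT : B4 g K T)
    (h : Run K C f T g P s) (hb : BoundedIterates s) {ν : ℕ → ℕ} (hν : Tendsto ν atTop atTop)
    {p : E} (hp : WeaklyTendsto (s.v ∘ ν) p) :
    Tendsto (s.v ∘ ν) atTop (𝓝 p) ∧
      IsBregmanProj g (cutSetInf K C f s.y ∩ Fix K T) P.v0 p := by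
  obtain ⟨hvx, hxw⟩ := h.tendsto_sub hg h2 h3 hb
  have hvK : ∀ k, s.v k ∈ K := fun k => (h.partialRun k).v_mem
  have hfix : p ∈ Fix K T := by
    refine hT.demiclosed _ p (fun j => hvK (ν j)) hp ?_
    refine squeeze_zero (fun _ => Metric.infDist_nonneg) (fun j => ?_)
      ((tendsto_zero_iff_norm_tendsto_zero.1 hvx).comp hν)
    simpa [dist_eq_norm] using
      Metric.infDist_le_dist_of_mem (x := s.v (ν j)) (h.2 (ν j)).x_proj.1
  have hw : WeaklyTendsto (s.w ∘ ν) p := fun φ => by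
    have h5 : Tendsto (fun k => φ (s.v k - s.w k)) atTop (𝓝 0) := by
      have := (φ.continuous.tendsto 0).comp (hvx.add hxw |>.trans (by rw [add_zero]))
      simpa [Function.comp_def] using this
    have h6 := (hp φ).sub (h5.comp hν)
    simpa using h6
  have hcut : ∀ k, p ∈ cutSet K C f s.y k := fun k =>
    hw.mem_of_isClosed_of_convex (isClosed_cutSet hB2 hKcl _ _) (convex_cutSet hB3 hKcv _ _) (by
      filter_upwards [hν.eventually_ge_atTop k] with j hj
      exact cutSet_antitone K C f s.y (hj.trans (Nat.le_succ _)) (h.2 (ν j)).w_proj.1)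
  have hle : ∀ q ∈ cutSetInf K C f s.y ∩ Fix K T, ∀ k,
      bregmanDist g (s.v k) P.v0 ≤ bregmanDist g q P.v0 := fun q hq k =>
    h.bregmanDist_v_le hg hT hKcv hB3 hq.2
      (fun j => (mem_iInter.1 hq.1 j).1) k
  -- Nonemptiness of K_∞ ∩ Fix(T) is obtained here from the limit itself, without a dual solution.
  have hpΩ : p ∈ cutSetInf K C f s.y ∩ Fix K T := ⟨mem_iInter.2 fun k => hcut (k + 1), hfix⟩
  have hstrong : Tendsto (s.v ∘ ν) atTop (𝓝 p) := by
    have h5 : Tendsto (fun j => -(gateauxDeriv g p - gateauxDeriv g P.v0) ((s.v ∘ ν) j - p)) atTop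
        (𝓝 0) := by
      have := ((hp (gateauxDeriv g p - gateauxDeriv g P.v0)).sub_const
        ((gateauxDeriv g p - gateauxDeriv g P.v0) p)).neg
      simpa only [← map_sub, sub_self, map_zero, neg_zero] using this
    have h6 : Tendsto (fun j => bregmanDist g ((s.v ∘ ν) j) p) atTop (𝓝 0) := by
      refine squeeze_zero (fun j => hg.bregmanDist_nonneg _ _) (fun j => ?_) h5
      -- Since v^k is no farther from v^0 than p is, D(v^k, p) is at most a linear functional of v^k
      -- - p, which vanishes by weak convergence.
      have h7 := bregmanDist_three_point g ((s.v ∘ ν) j) p P.v0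
      have h8 : bregmanDist g ((s.v ∘ ν) j) P.v0 ≤ _ := hle p hpΩ (ν j)
      linarith
    have h7 := hg.tendsto_sub_of_tendsto_bregmanDist h2 (b := fun _ : ℕ => p)
      (isBounded_singleton.subset range_const_subset) h6
    simpa [Function.comp_def] using h7.add_const p
  exact ⟨hstrong, hpΩ, fun q hq => le_of_tendsto
    (((hg.continuous_bregmanDist h3 P.v0).tendsto p).comp hstrong)
    (Eventually.of_forall fun j => hle q hq (ν j))⟩

/-- Every subsequence has a further one converging to a projection of v^0 onto the same convex set,
and that projection is unique. -/
theorem Run.exists_tendsto (hE : IsReflexive E) (hKcl : IsClosed K) (hKcv : Convex ℝ K)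
    (hB2 : B2 f) (hB3 : B3 C f) (hg : IsBregmanFunction g) (h2 : H2 g) (h3 : H3 g)
    (hT : B4 g K T) (h : Run K C f T g P s) (hb : BoundedIterates s) :
    ∃ p, IsBregmanProj g (cutSetInf K C f s.y ∩ Fix K T) P.v0 p ∧ Tendsto s.v atTop (𝓝 p) := by
  have hsub : ∀ ν : ℕ → ℕ, Tendsto ν atTop atTop → ∃ (p : E) (ψ : ℕ → ℕ),
      Tendsto (s.v ∘ ν ∘ ψ) atTop (𝓝 p) ∧
        IsBregmanProj g (cutSetInf K C f s.y ∩ Fix K T) P.v0 p := fun ν hν => by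
    obtain ⟨p, ψ, hψ, hp⟩ := hE.exists_subseq_weaklyTendsto (u := s.v ∘ ν)
      (hb.2.1.subset (range_comp_subset_range _ _))
    exact ⟨p, ψ, h.tendsto_of_weaklyTendsto hKcl hKcv hB2 hB3 hg h2 h3 hT hb
      (hν.comp hψ.tendsto_atTop) hp⟩
  obtain ⟨p, -, -, hp⟩ := hsub id tendsto_id
  have hcv : Convex ℝ (cutSetInf K C f s.y ∩ Fix K T) :=
    (convex_iInter fun k => convex_cutSet hB3 hKcv _ _).inter (hT.convex_fix hg hKcv)
  refine ⟨p, hp, tendsto_of_subseq_tendsto fun ν hν => ?_⟩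
  obtain ⟨q, ψ, hq, hproj⟩ := hsub ν hν
  rw [← hg.isBregmanProj_unique hcv hproj hp]
  exact ⟨ψ, hq⟩

/-- The linesearch forces `D_g(z^k, x^k) → 0`. -/
theorem Run.tendsto_bregmanDist_z (hB1 : B1 f) (hB2 : B2 f) (hB3 : B3 C f)
    (hg : IsBregmanFunction g) (h : Run K C f T g P s) (hb : BoundedIterates s)
    (hbz : IsBounded (range s.z)) (hxw : Tendsto (fun k => s.x k - s.w k) atTop (𝓝 0)) :
    Tendsto (fun k => bregmanDist g (s.z k) (s.x k)) atTop (𝓝 0) := by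
  obtain ⟨hbx, -, hbw⟩ := hb
  have hθ := P.θ_mem
  -- all trial points lie in one bounded set
  have hbtrial : ∀ l : ℕ → ℕ, IsBounded (range fun k => trialPoint P.θ (s.x k) (s.z k) (l k)) := by
    intro l
    refine (isBounded_convexHull.2 (hbx.union hbz)).subset ?_
    rintro _ ⟨k, rfl⟩
    exact trialPoint_mem (A := convexHull ℝ (range s.x ∪ range s.z)) (convex_convexHull ℝ _) hθ
      (subset_convexHull ℝ _ (Or.inl (mem_range_self k)))
      (subset_convexHull ℝ _ (Or.inr (mem_range_self k))) _
  have hby : IsBounded (range s.y) := by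
    have : s.y = fun k => trialPoint P.θ (s.x k) (s.z k) (s.ℓ k) := funext fun k => (h.2 k).y_eq
    rw [this]
    exact hbtrial s.ℓ
  set D : ℕ → ℝ := fun k => bregmanDist g (s.z k) (s.x k) with hDdef
  set t : ℕ → ℝ := fun k => P.θ ^ s.ℓ k with htdef
  have ht0 : ∀ k, 0 < t k := fun k => pow_pos hθ.1 _
  have ht1 : ∀ k, t k ≤ 1 := fun k => pow_le_one₀ hθ.1.le hθ.2.le
  -- the accepted steps satisfy `t_k D_k → 0`
  have htD : ∀ η > 0, ∀ᶠ k in atTop, t k * (P.δ * D k) < η := by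
    intro η hη
    by_contra hnot
    rw [not_eventually] at hnot
    have hr : Tendsto (fun k => f (s.y k) (s.w k) - f (s.y k) (s.x k)) atTop (𝓝 0) :=
      hB2.tendsto_sub hby hby hbw hbx (by simp) (by simpa using hxw.neg)
    have hr' := P.tendsto_β_smul hr
    -- Restricting the filter to the bad indices plays the role of passing to a subsequence.
    set F := atTop ⊓ 𝓟 {k | ¬ t k * (P.δ * D k) < η}
    have hne : F.NeBot := frequently_mem_iff_neBot.1 hnot
    -- Since f(y^k, y^k) = 0 and y^k = t z^k + (1 - t) x^k, C-convexity puts t f(y^k, z^k) + (1 - t)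
    -- f(y^k, x^k) in C; w^k ∈ H_k gives the other term. Replacing w^k by x^k costs a vanishing
    -- error, and the result is t times the vector of the acceptance test.
    have hq : ∀ k, P.β k • (t k • f (s.y k) (s.z k) + (1 - t k) • f (s.y k) (s.x k))
        + P.β k • -f (s.y k) (s.w k) ∈ C := by
      intro k
      refine C.add_mem (smul_mem_cone (P.β_pos k).le ?_)
        (smul_mem_cone (P.β_pos k).le (h.2 k).w_proj.1.2)
      have h1 := hB3 (s.y k) (s.z k) (s.x k) (t k) (ht0 k).le (ht1 k)
      have h2 : t k • s.z k + (1 - t k) • s.x k = s.y k := (h.2 k).y_eq.symm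
      rwa [h2, hB1, sub_zero] at h1
    have hev := eventually_add_mem_interior (l := F) hη hq (hr'.mono_left inf_le_left)
      (P.e_tendsto.mono_left inf_le_left) P.ebar_mem P.e_mem
      (s := fun k => t k * (P.δ * D k))
      (eventually_inf_principal.2 (Eventually.of_forall fun k hk => not_lt.1 hk))
    obtain ⟨k, hk⟩ := hev.exists
    have hacc := (h.2 k).linesearch.1
    rw [acceptedExponents, mem_ofPred_eq, ← (h.2 k).y_eq] at hacc
    refine hacc ((smul_mem_interior_iff (ht0 k)).1 ?_)
    convert hk using 1
    module
  rw [tendsto_order]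
  refine ⟨fun a ha => Eventually.of_forall fun k => ha.trans_le (hg.bregmanDist_nonneg _ _),
    fun η hη => ?_⟩
  by_contra hnot
  rw [not_eventually] at hnot
  set F := atTop ⊓ 𝓟 {k | ¬ D k < η}
  have hne : F.NeBot := frequently_mem_iff_neBot.1 hnot
  have hFD : ∀ᶠ k in F, η ≤ D k :=
    eventually_inf_principal.2 (Eventually.of_forall fun k hk => not_lt.1 hk)
  have htlim : Tendsto t F (𝓝 0) := by
    rw [tendsto_order]
    refine ⟨fun a ha => Eventually.of_forall fun k => ha.trans (ht0 k), fun c hc => ?_⟩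
    filter_upwards [hFD, (htD (c * (P.δ * η)) (mul_pos hc (mul_pos P.δ_mem.1 hη))).filter_mono
      inf_le_left] with k hk1 hk2
    by_contra! hle
    have := mul_le_mul hle (mul_le_mul_of_nonneg_left hk1 P.δ_mem.1.le)
      (mul_pos P.δ_mem.1 hη).le (ht0 k).le
    linarith
  -- so the preceding trial points, which were rejected, approach `x^k`
  set u : ℕ → E := fun k => trialPoint P.θ (s.x k) (s.z k) (s.ℓ k - 1) with hudef
  have hbu : IsBounded (range u) := hbtrial fun k => s.ℓ k - 1
  -- Along F the steps tend to 0, so ℓ(k) - 1 is a genuine predecessor and not a truncated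
  -- subtraction.
  have hℓ : ∀ᶠ k in F, s.ℓ k ≠ 0 := by
    filter_upwards [htlim.eventually (gt_mem_nhds one_pos)] with k hk h0
    simp [htdef, h0] at hk
  have hux : Tendsto (fun k => u k - s.x k) F (𝓝 0) := by
    obtain ⟨R, hR⟩ := (hbz.union hbx).exists_norm_le
    have hlim : Tendsto (fun k => t k / P.θ * (R + R)) F (𝓝 0) := by
      simpa using (htlim.div_const P.θ).mul_const (R + R)
    refine squeeze_zero_norm' ?_ hlim
    filter_upwards [hℓ] with k hk
    have h1 : u k - s.x k = P.θ ^ (s.ℓ k - 1) • (s.z k - s.x k) := by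
      simp only [hudef, trialPoint]
      module
    have h2 : P.θ ^ (s.ℓ k - 1) = t k / P.θ := by
      rw [eq_div_iff hθ.1.ne', ← pow_succ, Nat.sub_add_cancel (Nat.one_le_iff_ne_zero.2 hk)]
    rw [h1, norm_smul, h2, Real.norm_of_nonneg (div_pos (ht0 k) hθ.1).le]
    exact mul_le_mul_of_nonneg_left ((norm_sub_le _ _).trans (add_le_add
      (hR _ (Or.inl (mem_range_self k))) (hR _ (Or.inr (mem_range_self k)))))
      (div_pos (ht0 k) hθ.1).le
  have hr1 : Tendsto (fun k => f (s.x k) (s.z k) - f (u k) (s.z k)) F (𝓝 0) :=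
    hB2.tendsto_sub hbx hbu hbz hbz (by simpa using hux.neg) (by simp)
  have hr2 : Tendsto (fun k => f (u k) (s.x k) - f (s.x k) (s.x k)) F (𝓝 0) :=
    hB2.tendsto_sub hbu hbx hbx hbx hux (by simp)
  have hr := P.tendsto_β_smul (by simpa using hr1.add hr2)
  have hδη : 0 < (1 - P.δ) * η := mul_pos (sub_pos.2 P.δ_mem.2) hη
  -- The gap (1 - δ) D e^k absorbs the error of replacing u by x^k; added to the rejected test it
  -- contradicts the efficiency of z^k.
  have hev := eventually_add_mem_interior (C := C) (q := fun _ => (0 : Y)) hδη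
    (fun _ => C.zero_mem) hr (P.e_tendsto.mono_left inf_le_left) P.ebar_mem P.e_mem
    (s := fun k => (1 - P.δ) * D k)
    (hFD.mono fun k hk => mul_le_mul_of_nonneg_left hk (sub_pos.2 P.δ_mem.2).le)
  obtain ⟨k, hk, hkℓ⟩ := (hev.and hℓ).exists
  have hrej : -(P.β k • f (u k) (s.x k)) + P.β k • f (u k) (s.z k) + (P.δ * D k) • P.e k ∈ C := by
    by_contra hrej
    have hacc : s.ℓ k - 1 ∈ acceptedExponents C f g P.δ P.θ (P.β k) (P.e k) (s.x k) (s.z k) :=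
      fun hmem => hrej (interior_subset hmem)
    have := (h.2 k).linesearch.2 hacc
    omega
  have hx := (h.2 k).x_proj.1
  refine notMem_interior_of_mem_zCandidates_self hB1 (h.2 k).z_mem hx ?_
  have h5 := add_mem_interior hk hrej
  convert h5 using 1
  rw [hB1]
  simp only [hDdef]
  module

/-- The limit of a bounded run solves the problem. -/
theorem Run.mem_S_of_tendsto (hB1 : B1 f) (hB2 : B2 f) (hB3 : B3 C f) (hg : IsBregmanFunction g)
    (h2 : H2 g) (h3 : H3 g) (h4 : H4 g) (hT : B4 g K T) (h : Run K C f T g P s)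
    (hb : BoundedIterates s) {p : E} (hp : p ∈ Fix K T) (hv : Tendsto s.v atTop (𝓝 p)) :
    p ∈ S K C f T := by
  obtain ⟨hvx, hxw⟩ := h.tendsto_sub hg h2 h3 hb
  have hvK : ∀ k, s.v k ∈ K := fun k => (h.partialRun k).v_mem
  have hx : Tendsto s.x atTop (𝓝 p) := by simpa using hv.sub hvx
  have hbz : IsBounded (range s.z) := isBounded_range_z hB1 hB2 hB3 hg h3 h4 hb.1
    (fun k => (h.2 k).x_proj.1) (fun k => (h.2 k).z_mem)
  have hzx := hg.tendsto_sub_of_tendsto_bregmanDist h2 hb.1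
    (h.tendsto_bregmanDist_z hB1 hB2 hB3 hg hb hbz hxw)
  have hz : Tendsto s.z atTop (𝓝 p) := by simpa using hzx.add hx
  -- The β_k need not converge, so the limit is taken along a subsequence.
  obtain ⟨β, hβ, ψ, hψ, hβψ⟩ := isCompact_Icc.tendsto_subseq P.β_mem
  refine ⟨hp, hg.notMem_interior_of_regularized hB1 hB3 (P.βlo_pos.trans_le hβ.1)
    (hT.convex _ hp.1) hp.2 (e := P.ebar) fun y hy => ?_⟩
  -- The constraint set T(v^k) moves; lower semicontinuity supplies competitors in it that tend to
  -- y.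
  obtain ⟨q, hqT, hq⟩ := hT.lsc p hp.1 s.v hvK hv y hy
  have hψ' := hψ.tendsto_atTop
  have hgc := hg.continuous h3
  have hgdc : Continuous (gateauxDeriv g) := continuous_of_uniformContinuousOn_isBounded h3
  have hfz : Tendsto (fun k => f (s.x k) (s.z k)) atTop (𝓝 (f p p)) :=
    (hB2.continuous.tendsto (p, p)).comp (hx.prodMk_nhds hz)
  have hfq : Tendsto (fun k => f (s.x k) (q k)) atTop (𝓝 (f p y)) :=
    (hB2.continuous.tendsto (p, y)).comp (hx.prodMk_nhds hq)
  have hcoef : Tendsto (fun k => g (s.z k) - g (q k) - gateauxDeriv g (s.x k) (s.z k - q k)) atTop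
      (𝓝 (g p - g y - gateauxDeriv g p (p - y))) :=
    (((hgc.tendsto p).comp hz).sub ((hgc.tendsto y).comp hq)).sub
      ((isBoundedBilinearMap_apply.continuous.tendsto (gateauxDeriv g p, p - y)).comp
        (((hgdc.tendsto p).comp hx).prodMk_nhds (hz.sub hq)))
  have hlim := ((hβψ.smul (hfz.comp hψ')).sub (hβψ.smul (hfq.comp hψ'))).add
    ((hcoef.comp hψ').smul (P.e_tendsto.comp hψ'))
  have hmem := notMem_interior_of_tendsto (C := C) hlim (Eventually.of_forall fun j =>
    notMem_interior_of_mem_zCandidates (h.2 (ψ j)).z_mem (hqT (ψ j)))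
  rw [hB1] at hmem
  convert hmem using 2
  simp only [bregmanDist, map_sub]
  module

end Convergence

end VQEP

theorem theorem3p1 {E Y : Type*}
    [NormedAddCommGroup E] [NormedSpace ℝ E] [CompleteSpace E]
    [NormedAddCommGroup Y] [NormedSpace ℝ Y] [CompleteSpace Y] [Nontrivial Y]
    (hE : VQEP.IsReflexive E)
    (K : Set E) (hKne : K.Nonempty) (hKcl : IsClosed K) (hKcv : Convex ℝ K)
    (C : ProperCone ℝ Y) (hC : VQEP.IsOrderingCone C)
    (f : E → E → Y) (hB1 : VQEP.B1 f) (hB2 : VQEP.B2 f) (hB3 : VQEP.B3 C f)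
    (g : E → ℝ) (hg : VQEP.IsBregmanFunction g)
    (hH1 : VQEP.H1 g) (hH2 : VQEP.H2 g) (hH3 : VQEP.H3 g) (hH4 : VQEP.H4 g)
    (T : E → Set E) (hB4 : VQEP.B4 g K T)
    (P : VQEP.Params K C) :
    -- (i)
    ((VQEP.DS K C f T).Nonempty →
      VQEP.WellDefined K C f T g P ∧
      ∀ s : VQEP.Iterates E, VQEP.Run K C f T g P s → VQEP.BoundedIterates s) ∧
    -- (ii), for an infinite run
    (∀ s : VQEP.Iterates E, VQEP.Run K C f T g P s → VQEP.BoundedIterates s →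
      ∃ p ∈ VQEP.S K C f T,
        VQEP.IsBregmanProj g (VQEP.cutSetInf K C f s.y ∩ VQEP.Fix K T) P.v0 p ∧
        Tendsto s.v atTop (𝓝 p) ∧ Tendsto s.x atTop (𝓝 p)) ∧
    -- (ii), for a run that stops
    (∀ (s : VQEP.Iterates E) (n : ℕ), VQEP.StopsAt K C f T g P s n →
      s.x n = s.v n ∧ s.x n ∈ VQEP.S K C f T) := by
  refine ⟨fun ⟨p, hp⟩ => ⟨VQEP.wellDefined_of_mem_DS hE hKcl hKcv hC hB1 hB2 hB3 hg hH3 hH4 hB4 hp,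
    fun s hs => hs.boundedIterates_of_mem_DS hKcv hB3 hg hH1 hH3 hH4 hB4 hp⟩,
    fun s hs hb => ?_, fun s n hs => hs.mem_S hg hB4 hB1 hB3⟩
  obtain ⟨p, hp, hv⟩ := hs.exists_tendsto hE hKcl hKcv hB2 hB3 hg hH2 hH3 hB4 hb
  refine ⟨p, hs.mem_S_of_tendsto hB1 hB2 hB3 hg hH2 hH3 hH4 hB4 hb hp.1.2 hv, hp, hv, ?_⟩
  simpa using hv.sub (hs.tendsto_sub hg hH2 hH3 hb).1
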